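/- **Setting.** Let $\mathcal X_0$ be a real Hilbert space, $\mathcal X\subset\mathcal X_0$ convex, $f_1,\dots,f_n$ and $w$ real functions on $\mathcal X_0$ that are differentiable at every point of $\mathcal X$, $\psi$ real-valued and convex on $\mathcal X$, $f=\frac1n\sum_i f_i$, $F=f+\psi$, and let $x^*$ be a minimizer of $F$ over $\mathcal X$. Write $D_h(x,y)=h(x)-h(y)-\langle\nabla h(y),x-y\rangle$, $G^*(v)=\sup_{y\in\mathcal X_0}(\langle v,y\rangle-G(y))$ and $\nabla f_{\mathcal I}=\frac1{|\mathcal I|}\sum_{i\in\mathcal I}\nabla f_i$. A function $G:\mathcal X_0\to[0,\infty)$ is a *CHEF* with parameters $(g,C_G)$, where $g:[0,\infty)\to[0,\infty)$ is increasing with $\lim_{\lambda\downarrow0}g^{-1}(\lambda)=0$ (here $g^{-1}(\lambda)=\inf\{t\ge0:g(t)\ge\lambda\}$) and $C_G>0$, if $G$ is convex with $G(0)=0$ and $G(-v)=G(v)$; $G(\lambda v)\ge\lambda g(\lambda)G(v)$ for all $v\in\mathcal X_0$, $\lambda>0$; and $\mathbb E\,G^*(\sum_s Z_s)\le C_G\sum_s\mathbb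 E\,G^*(Z_s)$ for all finite families of independent mean-zero $\mathcal X_0$-valued random vectors $Z_s$. Assume that for a CHEF $G$ with parameters $(g,C_G)$ and constants $L>0$, $\mu\ge0$: * (B1) $D_w(x,y)\ge G(x-y)$ for all $x,y\in\mathcal X$; * (B2) $0\le D_{f_i}(x,y)\le L\,G(x-y)$ for all $i$, all $x\in\mathcal X_0$ and all $y\in\mathcal X$; * (B3) $F(x)-F(x^*)\ge\mu D_w(x^*,x)$ for all $x\in\mathcal X$. **Algorithm (mirror-proximal SCSG).** Given are a possibly random $\tilde x_0\in\mathcal X$ and, for $j=1,\dots,T$, stepsizes $\eta_j>0$, reals $m_j>0$ and integers $1\le B_j\le n$, $1\le b_j\le n$. In epoch $j$, draw a uniformly random $\mathcal I_j\subset\{1,\dots,n\}$ with $|\mathcal I_j|=B_j$ and $N_j$ with $P(N_j=k)=(1-\gamma)\gamma^k$, $k\ge0$, $\gamma=\frac{m_j}{m_j+b_j}$; set $x_0=\tilde x_{j-1}$; for $k=1,\dots,N_j$ draw a uniformly random $\tilde{\mathcal I}_{k-1}$ with $|\tilde{\mathcal I}_{k-1}|=b_j$, put $\nu_{k-1}=\nabla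 f_{\tilde{\mathcal I}_{k-1}}(x_{k-1})-\nabla f_{\tilde{\mathcal I}_{k-1}}(x_0)+\nabla f_{\mathcal I_j}(x_0)$ and $$x_k\in\operatorname*{argmin}_{y\in\mathcal X}\Big(\langle\nu_{k-1},y\rangle+\psi(y)+\tfrac1{\eta_j}D_w(y,x_{k-1})\Big);$$ set $\tilde x_j=x_{N_j}$. All draws and $\tilde x_0$ are independent. The minimizers are assumed to exist and are chosen by a fixed rule that depends only on $j$, $\nu_{k-1}$, $x_{k-1}$; the quantities whose expectations are taken are assumed measurable. Let $$D_H=\frac Ln\sum_{i=1}^nG^*\Big(\frac{\nabla f_i(x^*)-\nabla f(x^*)}L\Big)\in[0,\infty].$$ **Theorem.** Let $\alpha>1$, $\xi>0$ and $\Gamma=\frac1{4\alpha^{1/\xi}}$. Let $1\le j\le T$ and assume $$6\eta_jL\le\min\Big\{1,\;b_j\,g\Big(\frac{\Gamma}{3C_G}\Big)\Big\},\qquad m_j\ge\frac{\max\{b_j,\;4C_G\alpha^j\}}{\Gamma},\qquad B_j\ge\frac5{8\Gamma}\,g\Big(\frac\Gamma{3C_G}\Big)\frac{m_j}{g(1/m_j)}.$$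 Then, as an inequality in $[0,\infty]$ (with $0$ for the last term if $B_j=n$), $$\mathbb E\big(F(\tilde x_j)-F(x^*)\big)+\Big(\frac{4b_j(1-\Gamma)}{3\eta_j}\frac1{m_j}+\frac\mu3\Big)\mathbb E D_w(x^*,\tilde x_j)\le4\Gamma\,\mathbb E\big(F(\tilde x_{j-1})-F(x^*)\big)+\frac{4b_j(1-\Gamma)}{3\eta_j}\frac1{m_j}\mathbb E D_w(x^*,\tilde x_{j-1})+\frac{D_H}{6\alpha^j}I(B_j<n).$$ -/

import Mathlib

open MeasureTheory ProbabilityTheory Filter Topology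
open scoped ENNReal

namespace MirrorSCSG

noncomputable section

/-- The Bregman divergence `D_h(x, y) = h x - h y - ⟨∇h y, x - y⟩`. -/
def bregman {E : Type*} [NormedAddCommGroup E] [InnerProductSpace ℝ E] [CompleteSpace E]
    (h : E → ℝ) (x y : E) : ℝ :=
  h x - h y - inner ℝ (gradient h y) (x - y)

/-- The convex conjugate `G* v = sup_y (⟨v, y⟩ - G y)` of a function with `G 0 = 0`. The term `y = 0`
is zero, so the supremum lies in `[0, ∞]` and cutting the other terms off at zero does not change
it. -/
def convexConj {E : Type*} [NormedAddCommGroup E] [InnerProductSpace ℝ E]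
    (G : E → ℝ) (v : E) : ℝ≥0∞ :=
  ⨆ y : E, ENNReal.ofReal (inner ℝ v y - G y)

/-- The (generalized) inverse `inf {t ≥ 0 | l ≤ g t} ∈ [0, ∞]` of an increasing function
`g : [0, ∞) → [0, ∞)`; only the values of `g` on `[0, ∞)` matter. -/
def increasingInv (g : ℝ → ℝ) (l : ℝ) : ℝ≥0∞ :=
  ⨅ t ∈ {t : ℝ | 0 ≤ t ∧ l ≤ g t}, ENNReal.ofReal t

/-- `G` is a convex sup-homogeneous envelope function (CHEF) with parameters `(g, CG)`.
The expectations in the generalized Nemirovsky inequality are `[0, ∞]`-valued. -/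
structure IsCHEF {E : Type*} [NormedAddCommGroup E] [InnerProductSpace ℝ E]
    [MeasurableSpace E] (G : E → ℝ) (g : ℝ → ℝ) (CG : ℝ) : Prop where
  g_nonneg : ∀ t, 0 ≤ t → 0 ≤ g t
  g_mono : MonotoneOn g (Set.Ici 0)
  g_inv : Tendsto (increasingInv g) (𝓝[>] 0) (𝓝 0)
  const_pos : 0 < CG
  nonneg : ∀ v, 0 ≤ G v
  zero : G 0 = 0
  convex : ConvexOn ℝ Set.univ G
  symm : ∀ v, G (-v) = G v
  sup_hom : ∀ (v : E) (l : ℝ), 0 < l → l * g l * G v ≤ G (l • v)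
  nemirovsky : ∀ (Ω : Type) [MeasurableSpace Ω] (P : Measure Ω) [IsProbabilityMeasure P]
    (r : ℕ) (Z : Fin r → Ω → E), (∀ s, Measurable (Z s)) → (∀ s, Integrable (Z s) P) →
    (∀ s, ∫ ω, Z s ω ∂P = 0) → iIndepFun Z P →
    ∫⁻ ω, convexConj G (∑ s, Z s ω) ∂P ≤ ENNReal.ofReal CG * ∑ s, ∫⁻ ω, convexConj G (Z s ω) ∂P

/-- The average loss `f = (1/n) ∑ᵢ fᵢ`. -/
def avgLoss {E : Type*} {n : ℕ} (f : Fin n → E → ℝ) (x : E) : ℝ :=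
  (1 / (n : ℝ)) * ∑ i, f i x

/-- The composite objective `F = f + ψ`. -/
def objective {E : Type*} {n : ℕ} (f : Fin n → E → ℝ) (ψ : E → ℝ) (x : E) : ℝ :=
  avgLoss f x + ψ x

/-- The batch gradient `∇f_S(x) = (1/|S|) ∑_{i ∈ S} ∇fᵢ(x)`. -/
def batchGrad {E : Type*} [NormedAddCommGroup E] [InnerProductSpace ℝ E] [CompleteSpace E]
    {n : ℕ} (f : Fin n → E → ℝ) (S : Finset (Fin n)) (x : E) : E :=
  (1 / (S.card : ℝ)) • ∑ i ∈ S, gradient (f i) x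

/-- The variance-reduced gradient `∇f_J(x) - ∇f_J(x₀) + ∇f_I(x₀)`. -/
def vrGrad {E : Type*} [NormedAddCommGroup E] [InnerProductSpace ℝ E] [CompleteSpace E]
    {n : ℕ} (f : Fin n → E → ℝ) (I J : Finset (Fin n)) (x₀ x : E) : E :=
  batchGrad f J x - batchGrad f J x₀ + batchGrad f I x₀

/-- The function minimized over `y` in the mirror-proximal step from `x` with gradient estimate `ν`
and stepsize `η`. -/
def proxObjective {E : Type*} [NormedAddCommGroup E] [InnerProductSpace ℝ E] [CompleteSpace E]
    (ψ w : E → ℝ) (η : ℝ) (ν x y : E) : ℝ :=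
  inner ℝ ν y + ψ y + (1 / η) * bregman w y x

/-- Inner iterates of an epoch that starts at `x₀`, with large batch `I` and mini-batches
`J 0, J 1, …`; `prox ν x` is the result of the mirror-proximal step. -/
def innerIter {E : Type*} [NormedAddCommGroup E] [InnerProductSpace ℝ E] [CompleteSpace E]
    {n : ℕ} (f : Fin n → E → ℝ) (prox : E → E → E) (x₀ : E) (I : Finset (Fin n))
    (J : ℕ → Finset (Fin n)) : ℕ → E
  | 0 => x₀
  | k + 1 => prox (vrGrad f I (J k) x₀ (innerIter f prox x₀ I J k)) (innerIter f prox x₀ I J k)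

/-- Outer iterates of mirror-proximal SCSG for given realizations of the initial point, the large
batches, the inner-loop lengths and the mini-batches. Epochs are numbered from one. -/
def outerIter {E : Type*} [NormedAddCommGroup E] [InnerProductSpace ℝ E] [CompleteSpace E]
    {n : ℕ} (f : Fin n → E → ℝ) (prox : ℕ → E → E → E) (x₀ : E) (I : ℕ → Finset (Fin n))
    (N : ℕ → ℕ) (J : ℕ → ℕ → Finset (Fin n)) : ℕ → E
  | 0 => x₀
  | j + 1 => innerIter f (prox (j + 1)) (outerIter f prox x₀ I N J j) (I (j + 1)) (J (j + 1))
      (N (j + 1))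

/-- Labels for the sources of randomness of a run. -/
inductive Source where
  | initial : Source
  | batch (j : ℕ) : Source
  | steps (j : ℕ) : Source
  | mini (j k : ℕ) : Source

/-- The sigma-algebra generated by each source of randomness. -/
@[reducible] def sourceSigma {Ω E : Type*} [MeasurableSpace E] {n : ℕ} (X₀ : Ω → E)
    (I : ℕ → Ω → Finset (Fin n)) (N : ℕ → Ω → ℕ) (J : ℕ → ℕ → Ω → Finset (Fin n)) :
    Source → MeasurableSpace Ω
  | .initial => MeasurableSpace.comap X₀ inferInstance
  | .batch j => MeasurableSpace.comap (I j) ⊤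
  | .steps j => MeasurableSpace.comap (N j) ⊤
  | .mini j k => MeasurableSpace.comap (J j k) ⊤

/-- `(prox, X₀, I, N, J)` is a run of `T` epochs of mirror-proximal SCSG with stepsizes `η`, batch
sizes `B`, inner-loop sizes `m` and mini-batch sizes `b`, on the probability space `(Ω, P)`. -/
structure IsRun {Ω E : Type*} [MeasurableSpace Ω] (P : Measure Ω)
    [NormedAddCommGroup E] [InnerProductSpace ℝ E] [CompleteSpace E] [MeasurableSpace E]
    {n : ℕ} (X : Set E) (f : Fin n → E → ℝ) (ψ w : E → ℝ) (xs : E)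
    (T : ℕ) (η m : ℕ → ℝ) (B b : ℕ → ℕ) (prox : ℕ → E → E → E)
    (X₀ : Ω → E) (I : ℕ → Ω → Finset (Fin n)) (N : ℕ → Ω → ℕ)
    (J : ℕ → ℕ → Ω → Finset (Fin n)) : Prop where
  stepsize_pos : ∀ j ∈ Set.Icc 1 T, 0 < η j
  loop_pos : ∀ j ∈ Set.Icc 1 T, 0 < m j
  batch_size : ∀ j ∈ Set.Icc 1 T, 1 ≤ B j ∧ B j ≤ n
  mini_size : ∀ j ∈ Set.Icc 1 T, 1 ≤ b j ∧ b j ≤ n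
  /-- The mirror-proximal step returns a point of the `argmin` over `X`. -/
  prox_mem : ∀ j ∈ Set.Icc 1 T, ∀ S R : Finset (Fin n), S.card = B j → R.card = b j →
    ∀ x₀ ∈ X, ∀ x ∈ X, prox j (vrGrad f S R x₀ x) x ∈ X ∧
      IsMinOn (proxObjective ψ w (η j) (vrGrad f S R x₀ x) x) X (prox j (vrGrad f S R x₀ x) x)
  init_mem : ∀ ω, X₀ ω ∈ X
  init_meas : Measurable X₀
  /-- `I j` is a uniformly random subset of size `B j`. -/
  batch_meas : ∀ j S, MeasurableSet {ω | I j ω = S}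
  batch_law : ∀ j ∈ Set.Icc 1 T, ∀ S : Finset (Fin n),
    P {ω | I j ω = S} = if S.card = B j then ((n.choose (B j) : ℕ) : ℝ≥0∞)⁻¹ else 0
  /-- `J j k` is a uniformly random subset of size `b j`. -/
  mini_meas : ∀ j k S, MeasurableSet {ω | J j k ω = S}
  mini_law : ∀ j ∈ Set.Icc 1 T, ∀ (k : ℕ) (S : Finset (Fin n)),
    P {ω | J j k ω = S} = if S.card = b j then ((n.choose (b j) : ℕ) : ℝ≥0∞)⁻¹ else 0
  /-- `N j` is geometric with parameter `γ = m j / (m j + b j)`: `P(N j = k) = (1 - γ) γ ^ k`. -/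
  steps_meas : ∀ j k, MeasurableSet {ω | N j ω = k}
  steps_law : ∀ j ∈ Set.Icc 1 T, ∀ k : ℕ,
    P {ω | N j ω = k} = ENNReal.ofReal ((1 - m j / (m j + b j)) * (m j / (m j + b j)) ^ k)
  /-- All sources of randomness, the initial point included, are mutually independent. -/
  indep : iIndep (sourceSigma X₀ I N J) P
  /-- For fixed realizations of the samples, the objective and the divergence at the outer iterates
  are measurable functions of the random initial point. -/
  objective_meas : ∀ (I' : ℕ → Finset (Fin n)) (N' : ℕ → ℕ) (J' : ℕ → ℕ → Finset (Fin n)),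
    (∀ j ∈ Set.Icc 1 T, (I' j).card = B j) → (∀ j ∈ Set.Icc 1 T, ∀ k, (J' j k).card = b j) →
    ∀ j ≤ T, Measurable[MeasurableSpace.comap X₀ inferInstance]
      (fun ω => objective f ψ (outerIter f prox (X₀ ω) I' N' J' j))
  divergence_meas : ∀ (I' : ℕ → Finset (Fin n)) (N' : ℕ → ℕ) (J' : ℕ → ℕ → Finset (Fin n)),
    (∀ j ∈ Set.Icc 1 T, (I' j).card = B j) → (∀ j ∈ Set.Icc 1 T, ∀ k, (J' j k).card = b j) →
    ∀ j ≤ T, Measurable[MeasurableSpace.comap X₀ inferInstance]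
      (fun ω => bregman w xs (outerIter f prox (X₀ ω) I' N' J' j))

/-- The random outer iterate `x̃_j`. -/
def iterate {Ω E : Type*} [NormedAddCommGroup E] [InnerProductSpace ℝ E] [CompleteSpace E]
    {n : ℕ} (f : Fin n → E → ℝ) (prox : ℕ → E → E → E)
    (X₀ : Ω → E) (I : ℕ → Ω → Finset (Fin n)) (N : ℕ → Ω → ℕ)
    (J : ℕ → ℕ → Ω → Finset (Fin n)) (j : ℕ) (ω : Ω) : E :=
  outerIter f prox (X₀ ω) (fun i => I i ω) (fun i => N i ω) (fun i k => J i k ω) j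

/-- `E (F(x̃) - F(x*))`, as an element of `[0, ∞]`; the integrand is nonnegative when `x*` minimizes
`F` over a set that contains the values of `x̃`. -/
def expGap {Ω E : Type*} [MeasurableSpace Ω] (P : Measure Ω) {n : ℕ}
    (f : Fin n → E → ℝ) (ψ : E → ℝ) (xs : E) (x : Ω → E) : ℝ≥0∞ :=
  ∫⁻ ω, ENNReal.ofReal (objective f ψ (x ω) - objective f ψ xs) ∂P

/-- `E D_w(x*, x̃)`, as an element of `[0, ∞]`; the integrand is nonnegative for convex `w`. -/
def expDiv {Ω E : Type*} [MeasurableSpace Ω] (P : Measure Ω)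
    [NormedAddCommGroup E] [InnerProductSpace ℝ E] [CompleteSpace E]
    (w : E → ℝ) (xs : E) (x : Ω → E) : ℝ≥0∞ :=
  ∫⁻ ω, ENNReal.ofReal (bregman w xs (x ω)) ∂P

/-- `D_H = (L/n) ∑ᵢ G*((∇fᵢ(x*) - ∇f(x*)) / L) ∈ [0, ∞]`. -/
def dH {E : Type*} [NormedAddCommGroup E] [InnerProductSpace ℝ E] [CompleteSpace E]
    {n : ℕ} (f : Fin n → E → ℝ) (G : E → ℝ) (L : ℝ) (xs : E) : ℝ≥0∞ :=
  ENNReal.ofReal (L / n) *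
    ∑ i, convexConj G ((1 / L) • (gradient (f i) xs - gradient (avgLoss f) xs))

end

end MirrorSCSG

open MirrorSCSG

/-! Fix an epoch with starting point `x₀` and large batch `S`. The gradient estimate at `x` is
`∇f(x) + ζ + e`: the mini-batch noise `ζ` has conditional mean zero, while the batch error `e` at
`x₀` stays frozen during the epoch. A mirror-proximal step satisfies a three-point inequality
against every point `u` of `X`; it is used at `u = x*` with weight `1 - Γ` and at the anchor `u =
x₀` with weight `Γ` (`mixed_step_le`).

The anchor inequality contributes `-Γ D_f(x₀, x)`, and this pays for `ζ`: cocoercivity bounds the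
conjugate envelope of the gradient differences by `D_{f_i}(x₀, x)`. The error `e` is split at `x₀`.
The part `⟨e, x₀ - x*⟩` averages to zero over `S`; the part `⟨e, x₀ - y⟩` goes by Fenchel–Young into
a conjugate term plus `c D_w(x₀, y)`. With `c = Γ(1 - γ)/η` the anchor terms become `(Γ/η)(D_w(x₀,
x_k) - γ D_w(x₀, x_{k+1}))`, which telescope against the weights `γ ^ k` and start from `D_w(x₀, x₀)
= 0`. These weights are, up to normalization, the law of the inner-loop length, so the weighted sums
are expectations at the end of the epoch (`geometric_sum_le`, `epoch_sum_le`).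

Both noises are averages of centered vectors over a random subset (`batchNoise_le`). Hoeffding's
comparison reduces sampling without replacement to independent sampling, where the Nemirovsky
inequality applies; sup-homogeneity of `G` turns the factor 1/batch size into a gain through `g`.
For the large batch, recentering at `x*` leaves `F(x₀) - F(x*)` and `D_H`.

Finally the bound for a fixed `x₀` is integrated over the previous iterate. The samples of one epoch
take countably many values and are independent of the past, so conditioning is a countable sum
(`lintegral_sampleIter_succ`). Everything lives in `[0, ∞]`, so no integrability is needed. -/

namespace MirrorSCSG

/-! ### Convex conjugates: Jensen and Fenchel–Young. -/

section Conjugate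

variable {E : Type*} [NormedAddCommGroup E] [InnerProductSpace ℝ E]

lemma le_convexConj (G : E → ℝ) (v y : E) :
    ENNReal.ofReal (inner ℝ v y - G y) ≤ convexConj G v :=
  le_iSup (fun y : E => ENNReal.ofReal (inner ℝ v y - G y)) y

lemma convexConj_neg {G : E → ℝ} (hG : ∀ v, G (-v) = G v) (v : E) :
    convexConj G (-v) = convexConj G v := by
  unfold convexConj
  rw [← (Equiv.neg E).iSup_comp]
  simp [hG]

lemma convexConj_zero {G : E → ℝ} (hG : ∀ v, 0 ≤ G v) : convexConj G 0 = 0 := by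
  unfold convexConj
  simp [hG]

/-- Jensen's inequality for the convex conjugate. -/
lemma convexConj_sum_le {ι : Type*} (G : E → ℝ) (s : Finset ι) (c : ι → ℝ) (v : ι → E)
    (hc : ∀ i ∈ s, 0 ≤ c i) (hc1 : ∑ i ∈ s, c i = 1) :
    convexConj G (∑ i ∈ s, c i • v i) ≤ ∑ i ∈ s, ENNReal.ofReal (c i) * convexConj G (v i) := by
  refine iSup_le fun y => ?_
  have h1 : inner ℝ (∑ i ∈ s, c i • v i) y - G y = ∑ i ∈ s, c i * (inner ℝ (v i) y - G y) := by
    simp_rw [mul_sub, Finset.sum_sub_distrib, ← Finset.sum_mul, hc1, sum_inner,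
      real_inner_smul_left, one_mul]
  rw [h1]
  refine (ENNReal.ofReal_le_ofReal (Finset.sum_le_sum fun i hi =>
    mul_le_mul_of_nonneg_left (le_max_left _ 0) (hc i hi))).trans ?_
  rw [ENNReal.ofReal_sum_of_nonneg fun i hi => mul_nonneg (hc i hi) (le_max_right _ _)]
  refine Finset.sum_le_sum fun i hi => ?_
  rw [ENNReal.ofReal_mul (hc i hi)]
  gcongr
  refine le_trans (le_of_eq ?_) (le_convexConj G (v i) y)
  rcases le_total (inner ℝ (v i) y - G y) 0 with h | h <;> simp [h, ENNReal.ofReal_of_nonpos]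

/-- The Fenchel–Young inequality with a scaling parameter. -/
lemma inner_le_convexConj {G : E → ℝ} {c : ℝ} (hc : 0 < c) (v y : E)
    (hfin : convexConj G ((1 / c) • v) ≠ ⊤) :
    inner ℝ v y ≤ c * (convexConj G ((1 / c) • v)).toReal + c * G y := by
  have h := (ENNReal.ofReal_le_iff_le_toReal hfin).1 (le_convexConj G ((1 / c) • v) y)
  rw [real_inner_smul_left] at h
  have := mul_le_mul_of_nonneg_left h hc.le
  have e : c * (1 / c * inner ℝ v y - G y) = inner ℝ v y - c * G y := by field_simp
  linarith

end Conjugate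

/-! ### Scaling consequences of the envelope axioms. -/

section CHEF

variable {E : Type*} [NormedAddCommGroup E] [InnerProductSpace ℝ E] [MeasurableSpace E]
  {G : E → ℝ} {g : ℝ → ℝ} {CG : ℝ}

/-- Since the generalized inverse tends to zero, some positive level is already reached by `g`
before `t`. -/
lemma IsCHEF.g_pos (hG : IsCHEF G g CG) {t : ℝ} (ht : 0 < t) : 0 < g t := by
  have h1 : ∀ᶠ l in 𝓝[>] (0 : ℝ), increasingInv g l < ENNReal.ofReal t :=
    hG.g_inv.eventually_lt_const (by simpa using ht)
  obtain ⟨l, hl, hl0⟩ := (h1.and self_mem_nhdsWithin).exists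
  simp only [increasingInv, iInf_lt_iff] at hl
  obtain ⟨s, ⟨hs0, hs⟩, hst⟩ := hl
  have hst' : s ≤ t := ((ENNReal.ofReal_lt_ofReal_iff ht).1 hst).le
  have hl0' : 0 < l := hl0
  have := hG.g_mono (Set.mem_Ici.2 hs0) (Set.mem_Ici.2 ht.le) hst'
  linarith

/-- Dual form of sup-homogeneity: substituting `l⁻¹ • y` in the supremum turns growth of `G` into
decay of its conjugate under small multiples. -/
lemma IsCHEF.convexConj_smul_le (hG : IsCHEF G g CG) {t l : ℝ} (ht : 0 ≤ t) (hl : 0 < l)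
    (htl : t ≤ g l) (v : E) :
    convexConj G (t • v) ≤ ENNReal.ofReal (t * l) * convexConj G v := by
  refine iSup_le fun y => ?_
  have h0 := le_convexConj G v (l⁻¹ • y)
  refine le_trans ?_ (mul_le_mul_right h0 _)
  rw [← ENNReal.ofReal_mul (by positivity)]
  apply ENNReal.ofReal_le_ofReal
  have h1 := hG.sup_hom (l⁻¹ • y) l hl
  rw [smul_smul, mul_inv_cancel₀ hl.ne', one_smul] at h1
  rw [real_inner_smul_left, real_inner_smul_right]
  have h2 : t * l * (l⁻¹ * inner ℝ v y - G (l⁻¹ • y))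
      = t * inner ℝ v y - t * l * G (l⁻¹ • y) := by field_simp
  rw [h2]
  have h3 : t * l * G (l⁻¹ • y) ≤ l * g l * G (l⁻¹ • y) := by
    apply mul_le_mul_of_nonneg_right _ (hG.nonneg _)
    nlinarith
  linarith

end CHEF

/-! ### Sampling without replacement. -/

section Sampling

lemma exists_perm_map_eq {α : Type*} [Fintype α] [DecidableEq α] {S T : Finset α}
    (h : S.card = T.card) : ∃ σ : Equiv.Perm α, S.map σ.toEmbedding = T := by
  let e : {x // x ∈ S} ≃ {x // x ∈ T} := Finset.equivOfCardEq h
  refine ⟨e.extendSubtype, ?_⟩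
  refine Finset.eq_of_subset_of_card_le (fun y hy => ?_) (by simp [h])
  obtain ⟨x, hx, rfl⟩ := Finset.mem_map.1 hy
  exact e.extendSubtype_mem x hx

/-- Double counting of `h (σ T)` over `T` and `σ`: permutations act transitively on sets of a given
size, so the sum over `σ` does not depend on `T`, and each `σ` merely permutes the sets `T`. -/
lemma choose_mul_sum_perm_map {α : Type*} [Fintype α] [DecidableEq α] (h : Finset α → ℝ≥0∞)
    (S : Finset α) :
    ((Fintype.card α).choose S.card : ℝ≥0∞) * ∑ σ : Equiv.Perm α, h (S.map σ.toEmbedding)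
      = ((Fintype.card α).factorial : ℝ≥0∞) * ∑ T ∈ Finset.univ.powersetCard S.card, h T := by
  have h1 : ∀ T ∈ (Finset.univ : Finset α).powersetCard S.card,
      ∑ σ : Equiv.Perm α, h (T.map σ.toEmbedding)
        = ∑ σ : Equiv.Perm α, h (S.map σ.toEmbedding) := by
    intro T hT
    obtain ⟨ρ, rfl⟩ := exists_perm_map_eq (Finset.mem_powersetCard_univ.1 hT).symm
    refine Fintype.sum_equiv (Equiv.mulRight ρ) _ _ fun σ => ?_
    rw [Finset.map_map]
    rfl
  have h2 : ∀ σ : Equiv.Perm α,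
      ∑ T ∈ (Finset.univ : Finset α).powersetCard S.card, h (T.map σ.toEmbedding)
        = ∑ T ∈ Finset.univ.powersetCard S.card, h T := by
    intro σ
    refine Finset.sum_bij' (fun T _ => T.map σ.toEmbedding) (fun T _ => T.map σ.symm.toEmbedding)
      ?_ ?_ ?_ ?_ ?_
    · intro T hT; simpa using hT
    · intro T hT; simpa using hT
    · intro T _; ext; simp
    · intro T _; ext; simp
    · intro T _; rfl
  have h3 := Finset.sum_comm (s := (Finset.univ : Finset α).powersetCard S.card)
    (t := (Finset.univ : Finset (Equiv.Perm α))) (f := fun T σ => h (T.map σ.toEmbedding))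
  rw [Finset.sum_congr rfl h1, Finset.sum_congr rfl fun σ _ => h2 σ] at h3
  simpa [Fintype.card_perm] using h3

variable {E : Type*} [NormedAddCommGroup E] [InnerProductSpace ℝ E]

/-- The sum over `S` is the mean, over the cyclic shifts of `S`, of the sums along the shifted
tuple. Jensen applies, and the shifts are then absorbed into `σ`. -/
lemma sum_perm_convexConj_le {α : Type*} [Fintype α] [DecidableEq α] (G : E → ℝ) (z : α → E)
    {b : ℕ} (hb0 : 0 < b) (S : Finset α) (hS : S.card = b) (t : Fin b → α) (ht : ∀ s, t s ∈ S) :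
    ∑ σ : Equiv.Perm α, convexConj G (∑ i ∈ S.map σ.toEmbedding, z i)
      ≤ ∑ σ : Equiv.Perm α, convexConj G (∑ s, z (σ (t s))) := by
  have : NeZero b := ⟨hb0.ne'⟩
  let e : {x // x ∈ S} ≃ Fin b := Finset.equivFinOfCardEq hS
  -- Cyclic shift of `S` by `a`, extended by the identity; the orbit of each element under these
  -- shifts covers `S` exactly once.
  let τ : Fin b → Equiv.Perm α := fun a =>
    Equiv.Perm.ofSubtype (p := fun x => x ∈ S) (e.symm.permCongr (Equiv.addRight a))
  have hτ : ∀ (σ : Equiv.Perm α) (i : α), i ∈ S →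
      ∑ a, z (σ (τ a i)) = ∑ i ∈ S, z (σ i) := by
    intro σ i hi
    rw [← Finset.sum_coe_sort S]
    refine Fintype.sum_equiv ((Equiv.addLeft (e ⟨i, hi⟩)).trans e.symm) _ _ fun a => ?_
    simp only [τ]
    rw [Equiv.Perm.ofSubtype_apply_of_mem _ hi]
    simp [Equiv.permCongr_apply]
  have hJ : ∀ σ : Equiv.Perm α, convexConj G (∑ i ∈ S.map σ.toEmbedding, z i)
      ≤ ∑ a : Fin b, ENNReal.ofReal (1 / b) * convexConj G (∑ s, z ((σ * τ a) (t s))) := by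
    intro σ
    have hb0' : (b : ℝ) ≠ 0 := by positivity
    have h1 : ∑ i ∈ S.map σ.toEmbedding, z i
        = ∑ a : Fin b, (1 / b : ℝ) • ∑ s, z ((σ * τ a) (t s)) := by
      rw [← Finset.smul_sum, Finset.sum_comm]
      simp only [Equiv.Perm.mul_apply]
      rw [Finset.sum_congr rfl fun s _ => hτ σ (t s) (ht s)]
      rw [Finset.sum_const, Finset.card_univ, Fintype.card_fin, ← Nat.cast_smul_eq_nsmul ℝ,
        smul_smul, one_div, inv_mul_cancel₀ hb0', one_smul, Finset.sum_map]
      rfl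
    rw [h1]
    exact convexConj_sum_le G Finset.univ _ _ (fun _ _ => by positivity) (by simp [hb0'])
  refine (Finset.sum_le_sum fun σ _ => hJ σ).trans ?_
  rw [Finset.sum_comm]
  simp_rw [← Finset.mul_sum]
  have h2 : ∀ a : Fin b, ∑ σ : Equiv.Perm α, convexConj G (∑ s, z ((σ * τ a) (t s)))
      = ∑ σ : Equiv.Perm α, convexConj G (∑ s, z (σ (t s))) := fun a =>
    Fintype.sum_equiv (Equiv.mulRight (τ a)) _ _ fun σ => rfl
  simp_rw [h2]
  rw [Finset.sum_const, Finset.card_univ, Fintype.card_fin, nsmul_eq_mul, ← mul_assoc,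
    ← ENNReal.ofReal_natCast, ← ENNReal.ofReal_mul (by positivity)]
  have : (b : ℝ) ≠ 0 := by positivity
  rw [one_div, inv_mul_cancel₀ this]
  simp

/-- Hoeffding's comparison of sampling without and with replacement. -/
lemma sum_powersetCard_convexConj_le {n b : ℕ} (G : E → ℝ) (z : Fin n → E) (hb : 1 ≤ b)
    (hbn : b ≤ n) :
    ((n : ℝ≥0∞) ^ b) * ∑ S ∈ Finset.univ.powersetCard b, convexConj G (∑ i ∈ S, z i)
      ≤ (n.choose b : ℝ≥0∞) * ∑ t : Fin b → Fin n, convexConj G (∑ s, z (t s)) := by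
  have hfac : ((n.factorial : ℕ) : ℝ≥0∞) ≠ 0 := by exact_mod_cast n.factorial_ne_zero
  have key : ∀ t : Fin b → Fin n,
      (n.factorial : ℝ≥0∞) * ∑ S ∈ Finset.univ.powersetCard b, convexConj G (∑ i ∈ S, z i)
        ≤ (n.choose b : ℝ≥0∞)
          * ∑ σ : Equiv.Perm (Fin n), convexConj G (∑ s, z (σ (t s))) := by
    intro t
    -- A tuple may have repeated entries, so its image is enlarged to a set of exactly `b` elements.
    obtain ⟨S, hS, -, hSb⟩ := Finset.exists_subsuperset_card_eq
      (Finset.subset_univ (Finset.univ.image t)) (n := b)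
      (by simpa using Finset.card_image_le (s := Finset.univ) (f := t)) (by simpa using hbn)
    subst hSb
    have h1 := choose_mul_sum_perm_map (fun T => convexConj G (∑ i ∈ T, z i)) S
    rw [Fintype.card_fin] at h1
    rw [← h1]
    exact mul_le_mul_right (sum_perm_convexConj_le G z hb S rfl t
      fun s => hS (Finset.mem_image_of_mem t (Finset.mem_univ s))) _
  have h2 := Finset.sum_le_sum fun (t : Fin b → Fin n) (_ : t ∈ Finset.univ) => key t
  rw [← Finset.mul_sum, ← Finset.mul_sum, Finset.sum_comm (s := (Finset.univ : Finset (Fin b → Fin n)))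
    (t := (Finset.univ : Finset (Equiv.Perm (Fin n))))] at h2
  have h3 : ∀ σ : Equiv.Perm (Fin n), ∑ t : Fin b → Fin n, convexConj G (∑ s, z (σ (t s)))
      = ∑ t : Fin b → Fin n, convexConj G (∑ s, z (t s)) := fun σ =>
    Fintype.sum_equiv (Equiv.arrowCongr (Equiv.refl _) σ) _ _ fun t => rfl
  simp_rw [h3] at h2
  simp only [Finset.sum_const, Finset.card_univ, Fintype.card_perm, Fintype.card_fin,
    nsmul_eq_mul, Fintype.card_pi, Finset.prod_const, Nat.cast_pow] at h2
  refine (ENNReal.mul_le_mul_iff_right hfac (ENNReal.natCast_ne_top _)).1 ?_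
  calc _ = _ := by ring
    _ ≤ _ := h2
    _ = _ := by ring

/-- Each index lies in `(n - 1).choose (b - 1)` of the sets. -/
lemma sum_powersetCard_sum {n b : ℕ} (hb : 1 ≤ b) (z : Fin n → E) :
    ∑ S ∈ Finset.univ.powersetCard b, ∑ i ∈ S, z i
      = ((n - 1).choose (b - 1) : ℝ) • ∑ i, z i := by
  have h1 : ∀ S : Finset (Fin n), ∑ i ∈ S, z i = ∑ i, if i ∈ S then z i else 0 := by
    intro S; simp
  simp_rw [h1]
  rw [Finset.sum_comm, Finset.smul_sum]
  refine Finset.sum_congr rfl fun i _ => ?_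
  rw [← Finset.sum_filter, Finset.sum_const]
  have h2 := Finset.card_filter_powersetCard_subset {i} (Finset.univ : Finset (Fin n)) b
    (Finset.subset_univ _) (by simpa using hb)
  simp only [Finset.singleton_subset_iff, Finset.card_univ, Fintype.card_fin,
    Finset.card_singleton] at h2
  rw [h2, Nat.cast_smul_eq_nsmul, if_pos (Finset.mem_univ i)]

variable [CompleteSpace E] [MeasurableSpace E] {G : E → ℝ} {g : ℝ → ℝ} {CG : ℝ}

/-- The Nemirovsky inequality for the coordinates of the uniform product measure on tuples;
multiplying by `n ^ b` clears the probabilities. -/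
lemma IsCHEF.sum_tuple_convexConj_le (hG : IsCHEF G g CG) {n b : ℕ} (hn : 0 < n)
    (z : Fin n → E) (hz : ∑ i, z i = 0) :
    ∑ t : Fin b → Fin n, convexConj G (∑ s, z (t s))
      ≤ (n : ℝ≥0∞) ^ b * (ENNReal.ofReal (CG * b / n) * ∑ i, convexConj G (z i)) := by
  have : NeZero n := ⟨hn.ne'⟩
  have hn' : (n : ℝ≥0∞) ≠ 0 := by exact_mod_cast hn.ne'
  let ν : Measure (Fin n) := uniformOn Set.univ
  have hν : ∀ i, ν {i} = (n : ℝ≥0∞)⁻¹ := by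
    intro i
    simp [ν, uniformOn_univ]
  let P : Measure (Fin b → Fin n) := Measure.pi fun _ => ν
  have hP : ∀ t, P {t} = ((n : ℝ≥0∞) ^ b)⁻¹ := by
    intro t
    simp [P, Measure.pi_singleton, hν, ENNReal.inv_pow]
  have hmp : ∀ s : Fin b, MeasurePreserving (Function.eval s) P ν := fun s =>
    measurePreserving_eval _ s
  have hzm : Measurable z := measurable_of_finite z
  have hzi : Integrable z ν := Integrable.of_finite
  have hint : ∫ i, z i ∂ν = 0 := by
    rw [integral_fintype hzi]
    simp [measureReal_def, hν, ← Finset.smul_sum, hz]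
  have key := hG.nemirovsky (Fin b → Fin n) P b (fun s t => z (t s))
    (fun s => hzm.comp (measurable_pi_apply s))
    (fun s => (hmp s).integrable_comp_of_integrable hzi)
    (fun s => by
      have := integral_map (μ := P) (φ := Function.eval s) (f := z)
        (measurable_pi_apply s).aemeasurable
        (by rw [(hmp s).map_eq]; exact hzi.aestronglyMeasurable)
      rw [(hmp s).map_eq, hint] at this
      exact this.symm)
    (iIndepFun_pi fun s => hzm.aemeasurable)
  have hr : ∀ s : Fin b, ∫⁻ t, convexConj G (z (t s)) ∂P
      = (n : ℝ≥0∞)⁻¹ * ∑ i, convexConj G (z i) := by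
    intro s
    have := (hmp s).lintegral_comp (f := fun i => convexConj G (z i)) (measurable_of_finite _)
    refine this.trans ?_
    rw [lintegral_fintype]
    simp [hν, Finset.mul_sum, mul_comm]
  rw [lintegral_fintype] at key
  simp only [hP, hr] at key
  rw [← Finset.sum_mul, mul_comm] at key
  have hnb : (n : ℝ≥0∞) ^ b ≠ 0 := pow_ne_zero _ hn'
  have hnb' : (n : ℝ≥0∞) ^ b ≠ ⊤ := ENNReal.pow_ne_top (ENNReal.natCast_ne_top _)
  have key2 := mul_le_mul_right key ((n : ℝ≥0∞) ^ b)
  rw [← mul_assoc, ENNReal.mul_inv_cancel hnb hnb', one_mul] at key2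
  refine key2.trans (le_of_eq ?_)
  congr 1
  rw [Finset.sum_const, Finset.card_univ, Fintype.card_fin, nsmul_eq_mul, ← mul_assoc, ← mul_assoc,
    mul_div_assoc, ENNReal.ofReal_mul hG.const_pos.le, div_eq_mul_inv,
    ENNReal.ofReal_mul (by positivity), ENNReal.ofReal_inv_of_pos (by positivity)]
  simp [mul_assoc]

/-- The generalized Nemirovsky inequality for sampling without replacement. -/
lemma IsCHEF.sum_powersetCard_convexConj_le (hG : IsCHEF G g CG) {n b : ℕ} (hb : 1 ≤ b)
    (hbn : b ≤ n) (z : Fin n → E) (hz : ∑ i, z i = 0) :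
    ∑ S ∈ Finset.univ.powersetCard b, convexConj G (∑ i ∈ S, z i)
      ≤ (n.choose b : ℝ≥0∞) * (ENNReal.ofReal (CG * b / n) * ∑ i, convexConj G (z i)) := by
  have hn : 0 < n := by omega
  have hn' : (n : ℝ≥0∞) ≠ 0 := by exact_mod_cast hn.ne'
  have hnb : (n : ℝ≥0∞) ^ b ≠ 0 := pow_ne_zero _ hn'
  have hnb' : (n : ℝ≥0∞) ^ b ≠ ⊤ := ENNReal.pow_ne_top (ENNReal.natCast_ne_top _)
  refine (ENNReal.mul_le_mul_iff_right hnb hnb').1 ?_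
  refine (MirrorSCSG.sum_powersetCard_convexConj_le G z hb hbn).trans ?_
  refine (mul_le_mul_right (hG.sum_tuple_convexConj_le (b := b) hn z hz) _).trans (le_of_eq ?_)
  ring

end Sampling

/-! ### First-order optimality, three-point inequality and cocoercivity. -/

section Bregman

variable {E : Type*} [NormedAddCommGroup E] [InnerProductSpace ℝ E] [CompleteSpace E]

lemma bregman_self (h : E → ℝ) (x : E) : bregman h x x = 0 := by simp [bregman]

/-- First-order optimality for the sum of a differentiable and a convex function. -/
lemma inner_add_sub_nonneg_of_isMinOn {X : Set E} {ψ h : E → ℝ} {h' y u : E}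
    (hψ : ConvexOn ℝ X ψ) (hy : y ∈ X) (hu : u ∈ X) (hd : HasGradientAt h h' y)
    (hmin : IsMinOn (fun z => h z + ψ z) X y) : 0 ≤ inner ℝ h' (u - y) + ψ u - ψ y := by
  have hl : HasDerivAt (fun t : ℝ => y + t • (u - y)) (u - y) 0 := by
    simpa using ((hasDerivAt_id (0 : ℝ)).smul_const (u - y)).const_add y
  have hd' : HasDerivAt (fun t : ℝ => h (y + t • (u - y))) (inner ℝ h' (u - y)) 0 := by
    have := HasFDerivAt.comp_hasDerivAt (f := fun t : ℝ => y + t • (u - y)) (0 : ℝ) (l := h)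
      (by simpa using hd.hasFDerivAt) hl
    simpa [Function.comp_def] using this
  have hs := hd'.tendsto_slope_zero_right
  -- Along the segment, minimality and the chord bound for `ψ` control the difference quotient of
  -- `h` from below; `ψ` itself need not be differentiable.
  have hev : ∀ᶠ t : ℝ in 𝓝[>] 0,
      ψ y - ψ u ≤ t⁻¹ • (h (y + (0 + t) • (u - y)) - h (y + (0 : ℝ) • (u - y))) := by
    filter_upwards [Ioo_mem_nhdsGT (zero_lt_one' ℝ)] with t ht
    have e : (1 - t) • y + t • u = y + t • (u - y) := by module
    have hz := hψ.1 hy hu (sub_nonneg.2 ht.2.le) ht.1.le (by ring)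
    have hc := hψ.2 hy hu (sub_nonneg.2 ht.2.le) ht.1.le (by ring)
    rw [e] at hz hc
    have hm := isMinOn_iff.1 hmin _ hz
    simp only [smul_eq_mul, zero_add, zero_smul, add_zero] at hc hm ⊢
    rw [inv_mul_eq_div, le_div_iff₀ ht.1]
    nlinarith
  have := ge_of_tendsto hs hev
  linarith

lemma hasGradientAt_avgLoss {n : ℕ} {f : Fin n → E → ℝ} {x : E}
    (hf : ∀ i, DifferentiableAt ℝ (f i) x) :
    HasGradientAt (avgLoss f) ((1 / (n : ℝ)) • ∑ i, gradient (f i) x) x := by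
  have h1 : HasFDerivAt (fun z => ∑ i, f i z)
      (∑ i, (InnerProductSpace.toDual ℝ E) (gradient (f i) x)) x :=
    HasFDerivAt.fun_sum fun i _ => (hf i).hasGradientAt.hasFDerivAt
  rw [hasGradientAt_iff_hasFDerivAt, map_smul, map_sum]
  exact h1.const_mul _

lemma bregman_avgLoss {n : ℕ} {f : Fin n → E → ℝ} {y : E}
    (hf : ∀ i, DifferentiableAt ℝ (f i) y) (x : E) :
    bregman (avgLoss f) x y = (1 / (n : ℝ)) * ∑ i, bregman (f i) x y := by
  simp only [bregman, (hasGradientAt_avgLoss hf).gradient, Finset.sum_sub_distrib, avgLoss,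
    real_inner_smul_left, sum_inner]
  ring

/-- The three-point inequality for a mirror-proximal step. -/
lemma three_point {X : Set E} {ψ w : E → ℝ} {η : ℝ} {ν x y u : E}
    (hψ : ConvexOn ℝ X ψ) (hw : DifferentiableAt ℝ w y) (hy : y ∈ X) (hu : u ∈ X)
    (hmin : IsMinOn (proxObjective ψ w η ν x) X y) :
    inner ℝ ν (y - u) + ψ y - ψ u
      ≤ (1 / η) * (bregman w u x - bregman w u y - bregman w y x) := by
  have hd : HasGradientAt (fun z => inner ℝ ν z + (1 / η) * bregman w z x)
      (ν + (1 / η) • (gradient w y - gradient w x)) y := by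
    rw [hasGradientAt_iff_hasFDerivAt, map_add, map_smul, map_sub]
    refine HasFDerivAt.add ?_ (HasFDerivAt.const_mul ?_ _)
    · exact ((InnerProductSpace.toDual ℝ E) ν).hasFDerivAt
    · refine HasFDerivAt.sub (hw.hasGradientAt.hasFDerivAt.sub_const _) ?_
      exact ((InnerProductSpace.toDual ℝ E) (gradient w x)).hasFDerivAt.comp y
        ((hasFDerivAt_id y).sub_const x)
  have h := inner_add_sub_nonneg_of_isMinOn hψ hy hu hd (by
    convert hmin using 2 with z
    simp only [proxObjective]; ring)
  simp only [bregman]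
  simp only [inner_add_left, inner_sub_left, inner_sub_right, real_inner_smul_left] at h ⊢
  ring_nf at h ⊢
  linarith

/-- Cocoercivity of the gradient with respect to a symmetric envelope. -/
lemma convexConj_gradient_sub_le {h G : E → ℝ} {L : ℝ} {x y : E} (hL : 0 < L)
    (hG : ∀ v, G (-v) = G v) (hy : ∀ z, 0 ≤ bregman h z y)
    (hx : ∀ z, bregman h z x ≤ L * G (z - x)) :
    convexConj G ((1 / L) • (gradient h x - gradient h y))
      ≤ ENNReal.ofReal (bregman h x y / L) := by
  refine iSup_le fun v => ENNReal.ofReal_le_ofReal ?_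
  rw [le_div_iff₀ hL, real_inner_smul_left]
  -- The test point `x - v` may leave `X`, so both Bregman bounds are needed at arbitrary first
  -- arguments.
  have h1 := hy (x - v)
  have h2 := hx (x - v)
  have e : x - v - x = -v := by abel
  simp only [bregman, e, hG] at h1 h2 ⊢
  simp only [inner_sub_left, inner_sub_right, inner_neg_right] at h1 h2 ⊢
  have e2 : (1 / L * (inner ℝ (gradient h x) v - inner ℝ (gradient h y) v) - G v) * L
      = inner ℝ (gradient h x) v - inner ℝ (gradient h y) v - L * G v := by field_simp
  rw [e2]
  linarith

end Bregman

/-- The standing assumptions on the problem, without the strong-convexity condition. -/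
structure IsProblem {E : Type*} [NormedAddCommGroup E] [InnerProductSpace ℝ E] [CompleteSpace E]
    {n : ℕ} (X : Set E) (f : Fin n → E → ℝ) (ψ w : E → ℝ) (xs : E) (G : E → ℝ) (L : ℝ) :
    Prop where
  convexOn : ConvexOn ℝ X ψ
  diff_loss : ∀ i, ∀ x ∈ X, DifferentiableAt ℝ (f i) x
  diff_mirror : ∀ x ∈ X, DifferentiableAt ℝ w x
  mem : xs ∈ X
  isMinOn : IsMinOn (objective f ψ) X xs
  le_mirror : ∀ x ∈ X, ∀ y ∈ X, G (x - y) ≤ bregman w x y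
  pos : 0 < L
  loss_nonneg : ∀ i, ∀ x : E, ∀ y ∈ X, 0 ≤ bregman (f i) x y
  loss_le : ∀ i, ∀ x : E, ∀ y ∈ X, bregman (f i) x y ≤ L * G (x - y)
  card_pos : 0 < n
  env_nonneg : ∀ v, 0 ≤ G v
  env_symm : ∀ v, G (-v) = G v

/-! ### One mirror-proximal step. -/

section Step

variable {E : Type*} [NormedAddCommGroup E] [InnerProductSpace ℝ E] [CompleteSpace E]
  {n : ℕ} {X : Set E} {f : Fin n → E → ℝ} {ψ w : E → ℝ} {xs : E} {G : E → ℝ} {L : ℝ}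

lemma IsProblem.mirror_nonneg (H : IsProblem X f ψ w xs G L) {x y : E} (hx : x ∈ X)
    (hy : y ∈ X) : 0 ≤ bregman w x y :=
  (H.env_nonneg _).trans (H.le_mirror x hx y hy)

lemma IsProblem.gap_nonneg (H : IsProblem X f ψ w xs G L) {x : E} (hx : x ∈ X) :
    0 ≤ objective f ψ x - objective f ψ xs :=
  sub_nonneg.2 (isMinOn_iff.1 H.isMinOn x hx)

lemma IsProblem.gradient_avgLoss (H : IsProblem X f ψ w xs G L) {x : E} (hx : x ∈ X) :
    gradient (avgLoss f) x = (1 / (n : ℝ)) • ∑ i, gradient (f i) x :=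
  (hasGradientAt_avgLoss fun i => H.diff_loss i x hx).gradient

lemma IsProblem.avg_nonneg (H : IsProblem X f ψ w xs G L) (x : E) {y : E} (hy : y ∈ X) :
    0 ≤ bregman (avgLoss f) x y := by
  rw [bregman_avgLoss fun i => H.diff_loss i y hy]
  exact mul_nonneg (by positivity) (Finset.sum_nonneg fun i _ => H.loss_nonneg i x y hy)

lemma IsProblem.avg_le (H : IsProblem X f ψ w xs G L) (x : E) {y : E} (hy : y ∈ X) :
    bregman (avgLoss f) x y ≤ L * G (x - y) := by
  rw [bregman_avgLoss fun i => H.diff_loss i y hy]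
  have hn : (0 : ℝ) < n := by exact_mod_cast H.card_pos
  have := Finset.sum_le_sum fun (i : Fin n) (_ : i ∈ Finset.univ) => H.loss_le i x y hy
  rw [Finset.sum_const, Finset.card_univ, Fintype.card_fin, nsmul_eq_mul] at this
  rw [one_div, inv_mul_le_iff₀ hn]
  linarith

lemma IsProblem.bregman_le_gap (H : IsProblem X f ψ w xs G L) {x : E} (hx : x ∈ X) :
    bregman (avgLoss f) x xs ≤ objective f ψ x - objective f ψ xs := by
  have hd := (hasGradientAt_avgLoss fun i => H.diff_loss i xs H.mem)
  have h := inner_add_sub_nonneg_of_isMinOn H.convexOn H.mem hx hd H.isMinOn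
  rw [← hd.gradient] at h
  simp only [bregman, objective]
  linarith

lemma IsProblem.convexConj_gradient_le (H : IsProblem X f ψ w xs G L) (i : Fin n) {x y : E}
    (hx : x ∈ X) (hy : y ∈ X) :
    convexConj G ((1 / L) • (gradient (f i) x - gradient (f i) y))
      ≤ ENNReal.ofReal (bregman (f i) x y / L) :=
  convexConj_gradient_sub_le H.pos H.env_symm (fun z => H.loss_nonneg i z y hy)
    fun z => H.loss_le i z x hx

lemma IsProblem.objective_step_le (H : IsProblem X f ψ w xs G L) {η : ℝ} {ν x y u : E}
    (hx : x ∈ X) (hy : y ∈ X) (hu : u ∈ X) (hmin : IsMinOn (proxObjective ψ w η ν x) X y) :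
    objective f ψ y - objective f ψ u
      ≤ inner ℝ (gradient (avgLoss f) x - ν) (y - u) + L * G (y - x) - bregman (avgLoss f) u x
        + (1 / η) * (bregman w u x - bregman w u y - bregman w y x) := by
  have h1 := three_point H.convexOn (H.diff_mirror y hy) hy hu hmin
  have h2 := H.avg_le y hx
  have h3 : inner ℝ (gradient (avgLoss f) x - ν) (y - u)
      = inner ℝ (gradient (avgLoss f) x) (y - x) - inner ℝ (gradient (avgLoss f) x) (u - x)
        - inner ℝ ν (y - u) := by
    simp only [inner_sub_left, inner_sub_right]; ring
  rw [h3]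
  simp only [objective]
  simp only [bregman] at h1 h2 ⊢
  linarith

/-- The combination, with weights `1 - Γ` and `Γ`, of the step inequalities at the minimizer and at
the anchor point, for a gradient estimate with errors `ζ` and `e`. -/
lemma IsProblem.mixed_step_le (H : IsProblem X f ψ w xs G L) {η Γ c : ℝ} {ζ e x₀ x y : E}
    (hη : 0 < η) (hηL : 6 * η * L ≤ 1) (hΓ0 : 0 ≤ Γ) (hΓ1 : Γ ≤ 1) (hc : 0 < c)
    (hx₀ : x₀ ∈ X) (hx : x ∈ X) (hy : y ∈ X)
    (hmin : IsMinOn (proxObjective ψ w η (gradient (avgLoss f) x + ζ + e) x) X y)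
    (hζ : convexConj G ((1 / (2 / (3 * η))) • ζ) ≠ ⊤) (he : convexConj G ((1 / c) • e) ≠ ⊤) :
    objective f ψ y - objective f ψ xs
      ≤ (1 / η) * ((1 - Γ) * (bregman w xs x - bregman w xs y)
          + Γ * (bregman w x₀ x - bregman w x₀ y)) + c * bregman w x₀ y
        + (2 / (3 * η) * (convexConj G ((1 / (2 / (3 * η))) • ζ)).toReal
          - Γ * bregman (avgLoss f) x₀ x - inner ℝ ζ (x - ((1 - Γ) • xs + Γ • x₀)))
        + (Γ * (objective f ψ x₀ - objective f ψ xs) + c * (convexConj G ((1 / c) • e)).toReal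
          - (1 - Γ) * inner ℝ e (x₀ - xs)) := by
  have h1 := mul_le_mul_of_nonneg_left (H.objective_step_le hx hy H.mem hmin) (sub_nonneg.2 hΓ1)
  have h2 := mul_le_mul_of_nonneg_left (H.objective_step_le hx hy hx₀ hmin) hΓ0
  -- The constant `2 / (3η)` leaves room for the smoothness term: as `L ≤ 1 / (6η)`, the total is at
  -- most `5 / (6η)`, which `D_w(y, x) / η` absorbs in `h10`.
  have h3 := inner_le_convexConj (G := G) (c := 2 / (3 * η)) (by positivity) ζ (x - y) hζ
  have h4 := inner_le_convexConj (G := G) hc e (x₀ - y) he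
  have h5 := H.le_mirror x₀ hx₀ y hy
  have h6 := H.le_mirror y hy x hx
  have h7 := mul_le_mul_of_nonneg_left h5 hc.le
  have h8 : G (x - y) = G (y - x) := by rw [← H.env_symm, neg_sub]
  have h9 := mul_nonneg (sub_nonneg.2 hΓ1) (H.avg_nonneg xs hx)
  have h10 : (2 / (3 * η) + L) * G (y - x) ≤ (1 / η) * bregman w y x := by
    have hL' : L ≤ 1 / (6 * η) := by rw [le_div_iff₀ (by positivity)]; linarith
    have : 2 / (3 * η) + L ≤ 1 / η := by
      have e1 : 2 / (3 * η) + 1 / (6 * η) = 5 / 6 * (1 / η) := by field_simp; norm_num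
      have : 0 < 1 / η := by positivity
      linarith
    exact mul_le_mul this h6 (H.env_nonneg _) (by positivity)
  rw [h8] at h3
  have e0 : gradient (avgLoss f) x - (gradient (avgLoss f) x + ζ + e) = -ζ - e := by abel
  rw [e0] at h1 h2
  simp only [inner_sub_left, inner_neg_left, inner_sub_right, inner_add_right,
    real_inner_smul_right] at h1 h2 h3 h4 ⊢
  generalize convexConj G ((1 / (2 / (3 * η))) • ζ) = A at *
  generalize 2 / (3 * η) = c₁ at *
  linarith

end Step

/-! ### Conjugate envelope of batch errors. -/

section Noise

variable {E : Type*} [NormedAddCommGroup E] [InnerProductSpace ℝ E]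
  {n : ℕ} {G : E → ℝ} {g : ℝ → ℝ} {CG : ℝ}

lemma sum_sub_mean (hn : 0 < n) (v : Fin n → E) :
    ∑ i, (v i - (1 / (n : ℝ)) • ∑ k, v k) = 0 := by
  have hn' : (n : ℝ) ≠ 0 := by positivity
  rw [Finset.sum_sub_distrib, Finset.sum_const, Finset.card_univ, Fintype.card_fin,
    ← Nat.cast_smul_eq_nsmul ℝ, smul_smul, mul_one_div_cancel hn', one_smul, sub_self]

/-- The error of a batch average of centered vectors, in two parts. -/
noncomputable def batchNoise (v h : Fin n → E) (S : Finset (Fin n)) : E :=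
  (1 / (S.card : ℝ)) • ∑ i ∈ S, (v i - (1 / (n : ℝ)) • ∑ k, v k + h i)

lemma sum_batchNoise (hn : 0 < n) {b : ℕ} (hb : 1 ≤ b) (v h : Fin n → E) (hh : ∑ i, h i = 0) :
    ∑ S ∈ Finset.univ.powersetCard b, batchNoise v h S = 0 := by
  have h1 : ∀ S ∈ (Finset.univ : Finset (Fin n)).powersetCard b, batchNoise v h S
      = (1 / (b : ℝ)) • ∑ i ∈ S, (v i - (1 / (n : ℝ)) • ∑ k, v k + h i) := fun S hS => by
    rw [batchNoise, Finset.mem_powersetCard_univ.1 hS]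
  rw [Finset.sum_congr rfl h1, ← Finset.smul_sum, sum_powersetCard_sum hb,
    Finset.sum_add_distrib, sum_sub_mean hn, hh]
  simp

variable [MeasurableSpace E]

/-- Jensen over the three summands, hence the factor `1 / 3`. A second Jensen bounds the mean by the
`v i`, hence the factor `2`. -/
lemma IsCHEF.sum_convexConj_centered_le (hG : IsCHEF G g CG) (hn : 0 < n) (v h : Fin n → E) :
    ∑ i, convexConj G ((1 / 3 : ℝ) • (v i - (1 / (n : ℝ)) • ∑ k, v k + h i))
      ≤ ENNReal.ofReal (1 / 3) * (2 * ∑ i, convexConj G (v i) + ∑ i, convexConj G (h i)) := by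
  have hn' : (n : ℝ) ≠ 0 := by positivity
  have h1 : ∀ i, convexConj G ((1 / 3 : ℝ) • (v i - (1 / (n : ℝ)) • ∑ k, v k + h i))
      ≤ ENNReal.ofReal (1 / 3) * (convexConj G (v i)
        + convexConj G ((1 / (n : ℝ)) • ∑ k, v k) + convexConj G (h i)) := by
    intro i
    have := convexConj_sum_le G (Finset.univ : Finset (Fin 3)) (fun _ => (1 / 3 : ℝ))
      ![v i, -((1 / (n : ℝ)) • ∑ k, v k), h i] (fun _ _ => by positivity) (by simp)
    simp only [Fin.sum_univ_three, Matrix.cons_val_zero, Matrix.cons_val_one, Matrix.cons_val,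
      convexConj_neg hG.symm, ← mul_add, ← smul_add] at this
    rwa [sub_eq_add_neg]
  have h2 : convexConj G ((1 / (n : ℝ)) • ∑ k, v k)
      ≤ ENNReal.ofReal (1 / n) * ∑ i, convexConj G (v i) := by
    rw [Finset.smul_sum, Finset.mul_sum]
    exact convexConj_sum_le G _ _ _ (fun _ _ => by positivity) (by simp [hn'])
  refine (Finset.sum_le_sum fun i _ => h1 i).trans ?_
  rw [← Finset.mul_sum, Finset.sum_add_distrib, Finset.sum_add_distrib]
  refine mul_le_mul_right (add_le_add_left ?_ _) _
  rw [two_mul]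
  refine add_le_add_right ?_ _
  rw [Finset.sum_const, Finset.card_univ, Fintype.card_fin, nsmul_eq_mul]
  refine (mul_le_mul_right h2 _).trans (le_of_eq ?_)
  rw [← mul_assoc, ← ENNReal.ofReal_natCast, ← ENNReal.ofReal_mul (by positivity),
    mul_one_div_cancel hn']
  simp

variable [CompleteSpace E]

/-- The expected conjugate envelope of a batch error. -/
lemma IsCHEF.batchNoise_le (hG : IsCHEF G g CG) {b : ℕ} (hb : 1 ≤ b) (hbn : b ≤ n)
    {L c l : ℝ} (hL : 0 < L) (hc : 0 < c) (hl : 0 < l) (hcl : 3 * L / (b * c) ≤ g l)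
    (v h : Fin n → E) (hh : ∑ i, h i = 0) (d : Fin n → ℝ) (hd : ∀ i, 0 ≤ d i)
    (hvd : ∀ i, convexConj G ((1 / L) • v i) ≤ ENNReal.ofReal (d i / L)) {D : ℝ} (hD : 0 ≤ D)
    (hhD : ENNReal.ofReal (L / n) * ∑ i, convexConj G ((1 / L) • h i) ≤ ENNReal.ofReal D) :
    (∀ S ∈ Finset.univ.powersetCard b, convexConj G ((1 / c) • batchNoise v h S) ≠ ⊤) ∧
      ∑ S ∈ Finset.univ.powersetCard b, c * (convexConj G ((1 / c) • batchNoise v h S)).toReal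
        ≤ (n.choose b : ℝ) * (CG * l * (2 * ((1 / (n : ℝ)) * ∑ i, d i) + D)) := by
  have hn : 0 < n := by omega
  have hn' : (0 : ℝ) < n := by exact_mod_cast hn
  have hb' : (0 : ℝ) < b := by exact_mod_cast hb
  have hCG := hG.const_pos
  -- Collects the scalars `1 / c` and `1 / b`, the `L` from rescaling the gradients and the `3` from
  -- the three-term Jensen; what remains is `t ≤ g l`, the hypothesis of the scaling lemma.
  set t : ℝ := 3 * L / (b * c) with ht
  have ht0 : 0 < t := by positivity
  let V : Fin n → E := fun i => (1 / L) • v i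
  let W : Fin n → E := fun i => (1 / L) • h i
  let z : Fin n → E := fun i => t • ((1 / 3 : ℝ) • (V i - (1 / (n : ℝ)) • ∑ k, V k + W i))
  have hz0 : ∑ i, z i = 0 := by
    simp only [z, ← Finset.smul_sum, Finset.sum_add_distrib, sum_sub_mean hn V]
    simp [W, ← Finset.smul_sum, hh]
  have hzS : ∀ S ∈ (Finset.univ : Finset (Fin n)).powersetCard b,
      (1 / c) • batchNoise v h S = ∑ i ∈ S, z i := by
    intro S hS
    rw [batchNoise, Finset.mem_powersetCard_univ.1 hS, Finset.smul_sum, Finset.smul_sum]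
    refine Finset.sum_congr rfl fun i _ => ?_
    simp only [z, V, W, ← Finset.smul_sum]
    rw [smul_comm _ (1 / L), ← smul_sub, ← smul_add, smul_smul, smul_smul, smul_smul]
    congr 1
    rw [ht]
    field_simp
  have h1 := hG.sum_powersetCard_convexConj_le hb hbn z hz0
  have h2 : ∑ i, convexConj G (z i) ≤ ENNReal.ofReal (t * l / (3 * L) * (2 * ∑ i, d i + n * D)) := by
    refine (Finset.sum_le_sum fun i _ => hG.convexConj_smul_le ht0.le hl hcl _).trans ?_
    rw [← Finset.mul_sum]
    refine (mul_le_mul_right (hG.sum_convexConj_centered_le hn V W) _).trans ?_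
    have h3 : ∑ i, convexConj G (V i) ≤ ENNReal.ofReal (∑ i, d i / L) := by
      rw [ENNReal.ofReal_sum_of_nonneg fun i _ => div_nonneg (hd i) hL.le]
      exact Finset.sum_le_sum fun i _ => hvd i
    have h4 : ∑ i, convexConj G (W i) ≤ ENNReal.ofReal (n * D / L) := by
      have := mul_le_mul_right hhD (ENNReal.ofReal (n / L))
      rw [← mul_assoc, ← ENNReal.ofReal_mul (by positivity),
        ← ENNReal.ofReal_mul (by positivity)] at this
      have e : (n : ℝ) / L * (L / n) = 1 := by field_simp
      rw [e, ENNReal.ofReal_one, one_mul] at this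
      refine this.trans (le_of_eq ?_)
      congr 1; ring
    have hds : 0 ≤ ∑ i, d i / L := Finset.sum_nonneg fun i _ => div_nonneg (hd i) hL.le
    calc _ ≤ ENNReal.ofReal (t * l) * (ENNReal.ofReal (1 / 3)
          * (2 * ENNReal.ofReal (∑ i, d i / L) + ENNReal.ofReal (n * D / L))) := by gcongr
      _ = _ := by
        rw [← ENNReal.ofReal_ofNat 2, ← ENNReal.ofReal_mul (by positivity),
          ← ENNReal.ofReal_add (by positivity) (by positivity),
          ← ENNReal.ofReal_mul (by positivity), ← ENNReal.ofReal_mul (by positivity)]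
        congr 1
        rw [← Finset.sum_div]
        field_simp
  have hS0 : 0 ≤ ∑ i, d i := Finset.sum_nonneg fun i _ => hd i
  have h5 : ∑ S ∈ Finset.univ.powersetCard b, convexConj G ((1 / c) • batchNoise v h S)
      ≤ ENNReal.ofReal ((n.choose b : ℝ) * (CG * l * (2 * ((1 / (n : ℝ)) * ∑ i, d i) + D) / c)) := by
    rw [Finset.sum_congr rfl fun S hS => by rw [hzS S hS]]
    refine h1.trans ((mul_le_mul_right (mul_le_mul_right h2 _) _).trans (le_of_eq ?_))
    rw [← ENNReal.ofReal_natCast, ← ENNReal.ofReal_mul (by positivity),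
      ← ENNReal.ofReal_mul (by positivity)]
    congr 1
    rw [ht]
    field_simp
  have hne := ENNReal.sum_ne_top.1 (h5.trans_lt ENNReal.ofReal_lt_top).ne
  refine ⟨hne, ?_⟩
  rw [← Finset.mul_sum, ← ENNReal.toReal_sum hne]
  have h6 := ENNReal.toReal_le_of_le_ofReal (by positivity) h5
  refine (mul_le_mul_of_nonneg_left h6 hc.le).trans (le_of_eq ?_)
  field_simp

end Noise

/-! ### The Markov operator of an inner step. -/

section StepMean

variable {E : Type*} {n : ℕ}

/-- The expectation operator of a step driven by a uniformly random batch of size `b`. -/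
noncomputable def stepMean (b : ℕ) (step : Finset (Fin n) → E → E) : Module.End ℝ (E → ℝ) where
  toFun h := fun x => (1 / (n.choose b : ℝ)) * ∑ R ∈ Finset.univ.powersetCard b, h (step R x)
  map_add' h₁ h₂ := by
    ext x
    simp [Finset.sum_add_distrib, mul_add]
  map_smul' c h := by
    ext x
    simp [← Finset.mul_sum, mul_left_comm]

lemma stepMean_apply (b : ℕ) (step : Finset (Fin n) → E → E) (h : E → ℝ) (x : E) :
    stepMean b step h x
      = (1 / (n.choose b : ℝ)) * ∑ R ∈ Finset.univ.powersetCard b, h (step R x) := rfl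

lemma sum_powersetCard_const {b : ℕ} (c : ℝ) :
    ∑ _S ∈ (Finset.univ : Finset (Fin n)).powersetCard b, c = (n.choose b : ℝ) * c := by
  simp

lemma stepMean_const {b : ℕ} (hb : b ≤ n) (step : Finset (Fin n) → E → E) (c : ℝ) :
    stepMean b step (fun _ => c) = fun _ => c := by
  ext x
  have : (0 : ℝ) < n.choose b := by exact_mod_cast Nat.choose_pos hb
  rw [stepMean_apply, sum_powersetCard_const]
  field_simp

lemma stepMean_pow_const {b : ℕ} (hb : b ≤ n) (step : Finset (Fin n) → E → E) (c : ℝ) (k : ℕ) :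
    (stepMean b step ^ k) (fun _ => c) = fun _ => c := by
  induction k with
  | zero => rfl
  | succ k ih => rw [pow_succ, Module.End.mul_apply, stepMean_const hb, ih]

/-- Transports a one-step inequality valid on `X` to the expectation after `k` steps, because the
steps do not leave `X`. -/
lemma stepMean_pow_mono {b : ℕ} {step : Finset (Fin n) → E → E} {X : Set E}
    (hX : ∀ R ∈ Finset.univ.powersetCard b, ∀ x ∈ X, step R x ∈ X) {h₁ h₂ : E → ℝ}
    (h : ∀ x ∈ X, h₁ x ≤ h₂ x) (k : ℕ) :
    ∀ x ∈ X, (stepMean b step ^ k) h₁ x ≤ (stepMean b step ^ k) h₂ x := by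
  induction k with
  | zero => exact h
  | succ k ih =>
    intro x hx
    rw [pow_succ', Module.End.mul_apply, Module.End.mul_apply, stepMean_apply, stepMean_apply]
    refine mul_le_mul_of_nonneg_left (Finset.sum_le_sum fun R hR => ?_) (by positivity)
    exact ih _ (hX R hR x hx)

lemma stepMean_pow_nonneg {b : ℕ} (hb : b ≤ n) {step : Finset (Fin n) → E → E} {X : Set E}
    (hX : ∀ R ∈ Finset.univ.powersetCard b, ∀ x ∈ X, step R x ∈ X) {h : E → ℝ}
    (h0 : ∀ x ∈ X, 0 ≤ h x) (k : ℕ) {x : E} (hx : x ∈ X) : 0 ≤ (stepMean b step ^ k) h x := by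
  have := stepMean_pow_mono hX (h₁ := fun _ => 0) h0 k x hx
  rwa [stepMean_pow_const hb] at this

end StepMean

/-! ### Geometric summation. -/

section Recurrence

/-- Summation of a one-step recurrence against geometric weights. -/
lemma geometric_sum_le {a d d' : ℕ → ℝ} {γ η Γ c : ℝ} (hγ0 : 0 < γ) (hγ1 : γ < 1) (hη : 0 < η)
    (hΓ0 : 0 ≤ Γ) (hΓ1 : Γ ≤ 1) (ha : ∀ k, 0 ≤ a k) (hd : ∀ k, 0 ≤ d k) (hd' : ∀ k, 0 ≤ d' k)
    (hd0 : d' 0 = 0) (hc : 0 ≤ c)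
    (h : ∀ k, a (k + 1)
      ≤ (1 / η) * ((1 - Γ) * (d k - d (k + 1)) + Γ * (d' k - γ * d' (k + 1))) + c) (K : ℕ) :
    ∑ k ∈ Finset.range K, (1 - γ) * γ ^ k * a k
        + (1 - Γ) * ((1 - γ) / η) * ∑ k ∈ Finset.range K, (1 - γ) * γ ^ k * d k
      ≤ (1 - γ) * a 0 + (1 - Γ) * ((1 - γ) / η) * d 0 + γ * c := by
  -- The induction must keep the nonnegative boundary terms in `d K` and `d' K`; they are dropped
  -- only at the end. The factor `γ` before `d' (k + 1)` in the hypothesis is what makes the `d'`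
  -- part telescope.
  have key : ∀ K, ∑ k ∈ Finset.range (K + 1), (1 - γ) * γ ^ k * a k
        + (1 - Γ) * ((1 - γ) / η)
          * (∑ k ∈ Finset.range K, (1 - γ) * γ ^ k * d k + γ ^ K * d K)
        + Γ * ((1 - γ) / η) * (γ ^ (K + 1) * d' K)
      ≤ (1 - γ) * a 0 + (1 - Γ) * ((1 - γ) / η) * d 0 + γ * (1 - γ ^ K) * c := by
    intro K
    induction K with
    | zero => simp [hd0]
    | succ K ih =>
      rw [Finset.sum_range_succ, Finset.sum_range_succ (fun k => (1 - γ) * γ ^ k * d k)]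
      have hw : 0 ≤ (1 - γ) * γ ^ (K + 1) := mul_nonneg (by linarith) (by positivity)
      have := mul_le_mul_of_nonneg_left (h K) hw
      have e : (1 - γ) * γ ^ (K + 1)
            * ((1 / η) * ((1 - Γ) * (d K - d (K + 1)) + Γ * (d' K - γ * d' (K + 1))) + c)
          = -((1 - Γ) * ((1 - γ) / η)
              * ((1 - γ) * γ ^ K * d K + γ ^ (K + 1) * d (K + 1) - γ ^ K * d K))
            - Γ * ((1 - γ) / η) * (γ ^ (K + 1 + 1) * d' (K + 1) - γ ^ (K + 1) * d' K)
            + (γ * (1 - γ ^ (K + 1)) * c - γ * (1 - γ ^ K) * c) := by ring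
      rw [e] at this
      linarith
  have hp : 0 ≤ (1 - γ) / η := div_nonneg (by linarith) hη.le
  have hq : 0 ≤ (1 - Γ) * ((1 - γ) / η) := mul_nonneg (by linarith) hp
  have h1 := key K
  rw [Finset.sum_range_succ] at h1
  have h2 : 0 ≤ (1 - γ) * γ ^ K * a K :=
    mul_nonneg (mul_nonneg (by linarith) (by positivity)) (ha K)
  have h3 : 0 ≤ Γ * ((1 - γ) / η) * (γ ^ (K + 1) * d' K) :=
    mul_nonneg (mul_nonneg hΓ0 hp) (mul_nonneg (by positivity) (hd' K))
  have h4 : 0 ≤ (1 - Γ) * ((1 - γ) / η) * (γ ^ K * d K) :=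
    mul_nonneg hq (mul_nonneg (by positivity) (hd K))
  have h5 : γ * (1 - γ ^ K) * c ≤ γ * c := by
    have : 0 ≤ γ * γ ^ K * c := by positivity
    linarith
  rw [mul_add] at h1
  linarith

end Recurrence

/-! ### Averaging over a mini-batch. -/

section Epoch

variable {E : Type*} [NormedAddCommGroup E] [InnerProductSpace ℝ E] [CompleteSpace E]
  {n : ℕ} {X : Set E} {f : Fin n → E → ℝ} {ψ w : E → ℝ} {xs : E} {G : E → ℝ} {L : ℝ}

/-- The error of the batch gradient. -/
noncomputable def batchErr (f : Fin n → E → ℝ) (x : E) (S : Finset (Fin n)) : E :=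
  batchGrad f S x - gradient (avgLoss f) x

lemma batchNoise_eq (H : IsProblem X f ψ w xs G L) {x y : E} (hx : x ∈ X) (hy : y ∈ X)
    {S : Finset (Fin n)} (hS : 0 < S.card) :
    batchNoise (fun i => gradient (f i) x - gradient (f i) y)
        (fun i => gradient (f i) y - gradient (avgLoss f) y) S = batchErr f x S := by
  have hS' : (S.card : ℝ) ≠ 0 := by positivity
  rw [batchErr, batchGrad, batchNoise]
  have e : ∀ i, gradient (f i) x - gradient (f i) y
      - (1 / (n : ℝ)) • ∑ k, (gradient (f k) x - gradient (f k) y)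
      + (gradient (f i) y - gradient (avgLoss f) y)
      = gradient (f i) x - gradient (avgLoss f) x := by
    intro i
    rw [Finset.sum_sub_distrib, smul_sub, ← H.gradient_avgLoss hx, ← H.gradient_avgLoss hy]
    abel
  simp_rw [e]
  rw [Finset.sum_sub_distrib, Finset.sum_const, smul_sub, ← Nat.cast_smul_eq_nsmul ℝ, smul_smul,
    one_div_mul_cancel hS', one_smul]

/-- Separates the mini-batch noise, fresh at each step, from the batch error at `x₀`, fixed during
the epoch. -/
lemma vrGrad_eq (H : IsProblem X f ψ w xs G L) {x₀ x : E} (hx₀ : x₀ ∈ X) (hx : x ∈ X)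
    (S : Finset (Fin n)) {R : Finset (Fin n)} (hR : 0 < R.card) :
    vrGrad f S R x₀ x = gradient (avgLoss f) x
      + batchNoise (fun i => gradient (f i) x - gradient (f i) x₀) (fun _ => 0) R
      + batchErr f x₀ S := by
  have hR' : (R.card : ℝ) ≠ 0 := by positivity
  rw [vrGrad, batchErr, batchNoise, batchGrad, batchGrad, Finset.sum_sub_distrib, smul_sub,
    ← H.gradient_avgLoss hx, ← H.gradient_avgLoss hx₀]
  simp only [add_zero, Finset.sum_sub_distrib, Finset.sum_const, smul_sub]
  rw [← Nat.cast_smul_eq_nsmul ℝ, ← Nat.cast_smul_eq_nsmul ℝ, smul_smul, smul_smul,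
    one_div_mul_cancel hR', one_smul, one_smul]
  abel

lemma sum_gradient_sub (H : IsProblem X f ψ w xs G L) {x : E} (hx : x ∈ X) :
    ∑ i, (gradient (f i) x - gradient (avgLoss f) x) = 0 := by
  rw [H.gradient_avgLoss hx]
  exact sum_sub_mean H.card_pos _

lemma sum_batchErr (H : IsProblem X f ψ w xs G L) {x : E} (hx : x ∈ X) {b : ℕ} (hb : 1 ≤ b) :
    ∑ S ∈ Finset.univ.powersetCard b, batchErr f x S = 0 := by
  rw [← sum_batchNoise H.card_pos hb (fun i => gradient (f i) x - gradient (f i) x)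
    (fun i => gradient (f i) x - gradient (avgLoss f) x) (sum_gradient_sub H hx)]
  refine Finset.sum_congr rfl fun S hS => (batchNoise_eq H hx hx ?_).symm
  rw [Finset.mem_powersetCard_univ.1 hS]
  omega

variable [MeasurableSpace E] {g : ℝ → ℝ} {CG : ℝ}

/-- Averaging over mini-batches removes the inner product with the noise, and the conjugate of the
noise is dominated by the `-Γ D_f(x₀, x)` coming from the anchor inequality. -/
lemma IsProblem.minibatch_step_le (H : IsProblem X f ψ w xs G L) (hG : IsCHEF G g CG) {b : ℕ}
    (hb : 1 ≤ b) (hbn : b ≤ n) {η Γ c : ℝ} (hη : 0 < η) (hηL : 6 * η * L ≤ 1)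
    (hηg : 6 * η * L ≤ b * g (Γ / (3 * CG))) (hΓ0 : 0 < Γ) (hΓ1 : Γ ≤ 1) (hc : 0 < c)
    {prox : E → E → E} {S : Finset (Fin n)} {x₀ : E} (hx₀ : x₀ ∈ X)
    (hprox : ∀ R : Finset (Fin n), R.card = b → ∀ x ∈ X, prox (vrGrad f S R x₀ x) x ∈ X ∧
      IsMinOn (proxObjective ψ w η (vrGrad f S R x₀ x) x) X (prox (vrGrad f S R x₀ x) x))
    (he : convexConj G ((1 / c) • batchErr f x₀ S) ≠ ⊤) {x : E} (hx : x ∈ X) :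
    stepMean b (fun R x => prox (vrGrad f S R x₀ x) x)
        (fun y => objective f ψ y - objective f ψ xs) x
      ≤ (1 / η) * ((1 - Γ) * (bregman w xs x
            - stepMean b (fun R x => prox (vrGrad f S R x₀ x) x) (bregman w xs) x)
          + Γ * (bregman w x₀ x
            - stepMean b (fun R x => prox (vrGrad f S R x₀ x) x) (bregman w x₀) x))
        + c * stepMean b (fun R x => prox (vrGrad f S R x₀ x) x) (bregman w x₀) x
        + (Γ * (objective f ψ x₀ - objective f ψ xs)
          + c * (convexConj G ((1 / c) • batchErr f x₀ S)).toReal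
          - (1 - Γ) * inner ℝ (batchErr f x₀ S) (x₀ - xs)) := by
  have hCG := hG.const_pos
  have hL := H.pos
  have hb' : (0 : ℝ) < b := by exact_mod_cast hb
  have hC : (0 : ℝ) < n.choose b := by exact_mod_cast Nat.choose_pos hbn
  set C : ℝ := ((n.choose b : ℕ) : ℝ) with hCdef
  let u : Fin n → E := fun i => gradient (f i) x - gradient (f i) x₀
  let ζ : Finset (Fin n) → E := batchNoise u fun _ => 0
  -- The left side is `9ηL / (2b)`, below the `6ηL / b` allowed by the stepsize condition.
  have hcl : 3 * L / (b * (2 / (3 * η))) ≤ g (Γ / (3 * CG)) := by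
    rw [div_le_iff₀ (by positivity)]
    have e : g (Γ / (3 * CG)) * (b * (2 / (3 * η))) = (b * g (Γ / (3 * CG))) * (2 / (3 * η)) := by
      ring
    rw [e]
    refine le_trans ?_ (mul_le_mul_of_nonneg_right hηg (by positivity))
    field_simp
    norm_num
  -- Evenness of the conjugate lets cocoercivity be used with `x₀` first, matching the orientation
  -- of `D_f(x₀, x)`.
  obtain ⟨hfin, hsum⟩ := hG.batchNoise_le hb hbn hL (by positivity : 0 < 2 / (3 * η))
    (by positivity : 0 < Γ / (3 * CG)) hcl u (fun _ => 0) (by simp)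
    (fun i => bregman (f i) x₀ x) (fun i => H.loss_nonneg i x₀ x hx)
    (fun i => by
      rw [← convexConj_neg hG.symm, ← smul_neg, neg_sub]
      exact H.convexConj_gradient_le i hx₀ hx)
    (D := 0) le_rfl (by simp [convexConj_zero hG.nonneg])
  rw [← bregman_avgLoss fun i => H.diff_loss i x hx] at hsum
  have hz : ∑ R ∈ Finset.univ.powersetCard b, ζ R = 0 :=
    sum_batchNoise H.card_pos hb u _ (by simp)
  have hstep : ∀ R ∈ (Finset.univ : Finset (Fin n)).powersetCard b, _ := fun R hR => by
    have hRb := Finset.mem_powersetCard_univ.1 hR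
    obtain ⟨hmem, hmin⟩ := hprox R hRb x hx
    have hv := vrGrad_eq H hx₀ hx S (R := R) (by omega)
    have hmin' : IsMinOn (proxObjective ψ w η
      (gradient (avgLoss f) x + ζ R + batchErr f x₀ S) x) X (prox (vrGrad f S R x₀ x) x) := by
      rw [hv] at hmin ⊢; exact hmin
    exact H.mixed_step_le hη hηL hΓ0.le hΓ1 hc hx₀ hx hmem hmin' (hfin R hR) he
  have htot := Finset.sum_le_sum hstep
  have hin : ∑ R ∈ Finset.univ.powersetCard b,
      inner ℝ (ζ R) (x - ((1 - Γ) • xs + Γ • x₀)) = (0 : ℝ) := by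
    rw [← sum_inner, hz, inner_zero_left]
  simp only [Finset.sum_add_distrib, Finset.sum_sub_distrib, ← Finset.mul_sum,
    sum_powersetCard_const] at htot hsum
  rw [hin] at htot
  simp only [stepMean_apply, Finset.sum_sub_distrib, sum_powersetCard_const, ← hCdef] at *
  have hav := H.avg_nonneg x₀ hx
  have e1 : CG * (Γ / (3 * CG)) = Γ / 3 := by field_simp
  -- With `l = Γ / (3 CG)` the noise costs `2Γ / 3` times the divergence, less than the available
  -- `Γ`.
  have h3 : 2 / (3 * η) * ∑ R ∈ Finset.univ.powersetCard b,
      (convexConj G ((1 / (2 / (3 * η))) • ζ R)).toReal ≤ C * (Γ * bregman (avgLoss f) x₀ x) := by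
    refine hsum.trans (mul_le_mul_of_nonneg_left ?_ hC.le)
    rw [e1]
    nlinarith [mul_nonneg hΓ0.le hav]
  refine le_of_mul_le_mul_left ?_ hC
  have ec : ∀ t : ℝ, C * (1 / C * t) = t := fun t => by field_simp
  generalize ∑ R ∈ Finset.univ.powersetCard b,
      objective f ψ (prox (vrGrad f S R x₀ x) x) = s₁ at *
  generalize ∑ R ∈ Finset.univ.powersetCard b,
      bregman w xs (prox (vrGrad f S R x₀ x) x) = s₂ at *
  generalize ∑ R ∈ Finset.univ.powersetCard b,
      bregman w x₀ (prox (vrGrad f S R x₀ x) x) = s₃ at *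
  have e2 : ∀ p q r s t : ℝ, C * (1 / η * ((1 - Γ) * (p - 1 / C * q) + Γ * (r - 1 / C * s))
      + c * (1 / C * s) + t)
      = 1 / η * ((1 - Γ) * (C * p - q) + Γ * (C * r - s)) + c * s + C * t := by
    intros; field_simp
  rw [e2, ec]
  linarith

end Epoch

/-! ### Expectations along one epoch. -/

section EpochMean

variable {E : Type*} [NormedAddCommGroup E] [InnerProductSpace ℝ E] [CompleteSpace E]
  {n : ℕ} {X : Set E} {f : Fin n → E → ℝ} {ψ w : E → ℝ} {xs : E} {G : E → ℝ} {L : ℝ}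

lemma batchErr_univ (H : IsProblem X f ψ w xs G L) {x : E} (hx : x ∈ X) :
    batchErr f x Finset.univ = 0 := by
  rw [batchErr, batchGrad, H.gradient_avgLoss hx]
  simp

/-- One inner step as a function of the mini-batch and the current point. -/
noncomputable def batchStep (f : Fin n → E → ℝ) (prox : E → E → E) (S : Finset (Fin n)) (x₀ : E)
    (R : Finset (Fin n)) (x : E) : E :=
  prox (vrGrad f S R x₀ x) x

/-- The expectation of `h` at the `k`-th inner iterate of an epoch that starts at `x₀`. -/
noncomputable def epochMean (f : Fin n → E → ℝ) (prox : E → E → E) (B b : ℕ) (x₀ : E) (k : ℕ)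
    (h : E → ℝ) : ℝ :=
  (1 / (n.choose B : ℝ)) * ∑ S ∈ Finset.univ.powersetCard B,
    (stepMean b (batchStep f prox S x₀) ^ k) h x₀

lemma epochMean_zero (f : Fin n → E → ℝ) (prox : E → E → E) {B : ℕ} (hB : B ≤ n) (b : ℕ) (x₀ : E)
    (h : E → ℝ) : epochMean f prox B b x₀ 0 h = h x₀ := by
  have : (0 : ℝ) < n.choose B := by exact_mod_cast Nat.choose_pos hB
  simp only [epochMean, pow_zero, Module.End.one_apply, sum_powersetCard_const]
  field_simp

variable {prox : E → E → E} {η : ℝ} {B b : ℕ}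

lemma epochMean_mono {x₀ : E} (hx₀ : x₀ ∈ X)
    (hX : ∀ S ∈ Finset.univ.powersetCard B, ∀ R ∈ Finset.univ.powersetCard b, ∀ x ∈ X,
      batchStep f prox S x₀ R x ∈ X) {h₁ h₂ : E → ℝ} (h : ∀ x ∈ X, h₁ x ≤ h₂ x) (k : ℕ) :
    epochMean f prox B b x₀ k h₁ ≤ epochMean f prox B b x₀ k h₂ :=
  mul_le_mul_of_nonneg_left (Finset.sum_le_sum fun S hS => stepMean_pow_mono (hX S hS) h k x₀ hx₀)
    (by positivity)

lemma epochMean_nonneg (hbn : b ≤ n) {x₀ : E} (hx₀ : x₀ ∈ X)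
    (hX : ∀ S ∈ Finset.univ.powersetCard B, ∀ R ∈ Finset.univ.powersetCard b, ∀ x ∈ X,
      batchStep f prox S x₀ R x ∈ X) {h : E → ℝ} (h0 : ∀ x ∈ X, 0 ≤ h x) (k : ℕ) :
    0 ≤ epochMean f prox B b x₀ k h :=
  mul_nonneg (by positivity)
    (Finset.sum_nonneg fun S hS => stepMean_pow_nonneg hbn (hX S hS) h0 k hx₀)

lemma epochMean_smul (x₀ : E) (k : ℕ) (c : ℝ) (h : E → ℝ) :
    epochMean f prox B b x₀ k (c • h) = c * epochMean f prox B b x₀ k h := by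
  simp only [epochMean, map_smul, Pi.smul_apply, smul_eq_mul, ← Finset.mul_sum]
  ring

variable [MeasurableSpace E] {g : ℝ → ℝ} {CG : ℝ}

/-- The `k`-th power of the step operator is applied to the one-step inequality; averaging over the
large batch then removes `⟨e, x₀ - x*⟩`, as neither point depends on `S`. -/
lemma IsProblem.epochMean_succ_le (H : IsProblem X f ψ w xs G L) (hG : IsCHEF G g CG)
    (hb : 1 ≤ b) (hbn : b ≤ n) (hB : 1 ≤ B) (hBn : B ≤ n) {Γ c : ℝ} (hη : 0 < η)
    (hηL : 6 * η * L ≤ 1) (hηg : 6 * η * L ≤ b * g (Γ / (3 * CG))) (hΓ0 : 0 < Γ) (hΓ1 : Γ ≤ 1)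
    (hc : 0 < c) {x₀ : E} (hx₀ : x₀ ∈ X)
    (hprox : ∀ S R : Finset (Fin n), S.card = B → R.card = b → ∀ x ∈ X,
      prox (vrGrad f S R x₀ x) x ∈ X ∧
      IsMinOn (proxObjective ψ w η (vrGrad f S R x₀ x) x) X (prox (vrGrad f S R x₀ x) x))
    (hfin : ∀ S ∈ Finset.univ.powersetCard B,
      convexConj G ((1 / c) • batchErr f x₀ S) ≠ ⊤) {D : ℝ}
    (hD : ∑ S ∈ Finset.univ.powersetCard B,
      c * (convexConj G ((1 / c) • batchErr f x₀ S)).toReal ≤ (n.choose B : ℝ) * D) (k : ℕ) :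
    epochMean f prox B b x₀ (k + 1) (fun y => objective f ψ y - objective f ψ xs)
      ≤ (1 / η) * ((1 - Γ) * (epochMean f prox B b x₀ k (bregman w xs)
            - epochMean f prox B b x₀ (k + 1) (bregman w xs))
          + Γ * (epochMean f prox B b x₀ k (bregman w x₀)
            - epochMean f prox B b x₀ (k + 1) (bregman w x₀)))
        + c * epochMean f prox B b x₀ (k + 1) (bregman w x₀)
        + (Γ * (objective f ψ x₀ - objective f ψ xs) + D) := by
  have hC : (0 : ℝ) < n.choose B := by exact_mod_cast Nat.choose_pos hBn
  set C : ℝ := ((n.choose B : ℕ) : ℝ) with hCdef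
  have hS : ∀ S ∈ (Finset.univ : Finset (Fin n)).powersetCard B, _ := fun S hSm => by
    have hSB := Finset.mem_powersetCard_univ.1 hSm
    have hX : ∀ R ∈ Finset.univ.powersetCard b, ∀ x ∈ X, batchStep f prox S x₀ R x ∈ X :=
      fun R hR x hx => (hprox S R hSB (Finset.mem_powersetCard_univ.1 hR) x hx).1
    let Q := stepMean b (batchStep f prox S x₀)
    have h1 := stepMean_pow_mono hX
      (h₁ := Q fun y => objective f ψ y - objective f ψ xs)
      (h₂ := (1 / η) • ((1 - Γ) • (bregman w xs - Q (bregman w xs))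
        + Γ • (bregman w x₀ - Q (bregman w x₀))) + c • Q (bregman w x₀)
        + fun _ => (Γ * (objective f ψ x₀ - objective f ψ xs)
          + c * (convexConj G ((1 / c) • batchErr f x₀ S)).toReal
          - (1 - Γ) * inner ℝ (batchErr f x₀ S) (x₀ - xs)))
      (fun x hx => H.minibatch_step_le hG hb hbn hη hηL hηg hΓ0 hΓ1 hc hx₀
        (fun R hR x hx => hprox S R hSB hR x hx) (hfin S hSm) hx) k x₀ hx₀
    simp only [map_add, map_smul, map_sub, stepMean_pow_const hbn, Q, ← Module.End.mul_apply,
      ← pow_succ, Pi.add_apply, Pi.smul_apply, Pi.sub_apply, smul_eq_mul] at h1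
    exact h1
  have htot := Finset.sum_le_sum hS
  have hin : ∑ S ∈ Finset.univ.powersetCard B,
      inner ℝ (batchErr f x₀ S) (x₀ - xs) = (0 : ℝ) := by
    rw [← sum_inner, sum_batchErr H hx₀ hB, inner_zero_left]
  simp only [Finset.sum_add_distrib, Finset.sum_sub_distrib, ← Finset.mul_sum,
    sum_powersetCard_const] at htot hD
  rw [hin] at htot
  refine le_of_mul_le_mul_left ?_ hC
  have ec : ∀ t : ℝ, C * (1 / C * t) = t := fun t => by field_simp
  have e2 : ∀ p q r s t : ℝ, C * (1 / η * ((1 - Γ) * (1 / C * p - 1 / C * q)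
        + Γ * (1 / C * r - 1 / C * s)) + c * (1 / C * s) + t)
      = 1 / η * ((1 - Γ) * (p - q) + Γ * (r - s)) + c * s + C * t := by
    intros; field_simp
  simp only [epochMean, ← hCdef] at htot ⊢
  rw [e2, ec]
  linarith

/-- The bound for a single epoch, with the inner-loop length truncated. -/
lemma IsProblem.epoch_sum_le (H : IsProblem X f ψ w xs G L) (hG : IsCHEF G g CG)
    (hb : 1 ≤ b) (hbn : b ≤ n) (hB : 1 ≤ B) (hBn : B ≤ n) {Γ m μ : ℝ} (hη : 0 < η)
    (hηL : 6 * η * L ≤ 1) (hηg : 6 * η * L ≤ b * g (Γ / (3 * CG))) (hΓ0 : 0 < Γ) (hΓ1 : Γ ≤ 1)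
    (hm : 0 < m) (hbm : b ≤ Γ * m)
    (hμ : ∀ x ∈ X, μ * bregman w xs x ≤ objective f ψ x - objective f ψ xs)
    {x₀ : E} (hx₀ : x₀ ∈ X)
    (hprox : ∀ S R : Finset (Fin n), S.card = B → R.card = b → ∀ x ∈ X,
      prox (vrGrad f S R x₀ x) x ∈ X ∧
      IsMinOn (proxObjective ψ w η (vrGrad f S R x₀ x) x) X (prox (vrGrad f S R x₀ x) x))
    {c D : ℝ} (hc : c = Γ * (1 - m / (m + b)) / η)
    (hfin : ∀ S ∈ Finset.univ.powersetCard B,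
      convexConj G ((1 / c) • batchErr f x₀ S) ≠ ⊤) (hD0 : 0 ≤ D)
    (hD : ∑ S ∈ Finset.univ.powersetCard B,
      c * (convexConj G ((1 / c) • batchErr f x₀ S)).toReal
        ≤ (n.choose B : ℝ) * (Γ / 2 * (objective f ψ x₀ - objective f ψ xs) + D)) (K : ℕ) :
    ∑ k ∈ Finset.range K, (1 - m / (m + b)) * (m / (m + b)) ^ k
          * epochMean f prox B b x₀ k (fun y => objective f ψ y - objective f ψ xs)
        + (4 * b * (1 - Γ) / (3 * η) * (1 / m) + μ / 3)
          * ∑ k ∈ Finset.range K, (1 - m / (m + b)) * (m / (m + b)) ^ k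
            * epochMean f prox B b x₀ k (bregman w xs)
      ≤ 4 * Γ * (objective f ψ x₀ - objective f ψ xs)
        + 4 * b * (1 - Γ) / (3 * η) * (1 / m) * bregman w xs x₀ + 4 / 3 * D := by
  have hb' : (0 : ℝ) < b := by exact_mod_cast hb
  have hX : ∀ S ∈ Finset.univ.powersetCard B, ∀ R ∈ Finset.univ.powersetCard b, ∀ x ∈ X,
      batchStep f prox S x₀ R x ∈ X := fun S hS R hR x hx =>
    (hprox S R (Finset.mem_powersetCard_univ.1 hS) (Finset.mem_powersetCard_univ.1 hR) x hx).1
  have hγp : 1 - m / (m + b) = m / (m + b) * (b / m) := by field_simp; ring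
  have hγ0 : 0 < m / (m + b) := by positivity
  have hp0 : 0 < 1 - m / (m + b) := by rw [hγp]; positivity
  set γ := m / (m + b) with hγ
  have hγ1 : γ < 1 := by linarith
  have hc0 : 0 < c := by rw [hc]; positivity
  have hΔ0 := H.gap_nonneg hx₀
  set Δ₀ := objective f ψ x₀ - objective f ψ xs with hΔ₀
  set a : ℕ → ℝ := fun k =>
    epochMean f prox B b x₀ k (fun y => objective f ψ y - objective f ψ xs) with ha
  set d : ℕ → ℝ := fun k => epochMean f prox B b x₀ k (bregman w xs) with hd
  set d' : ℕ → ℝ := fun k => epochMean f prox B b x₀ k (bregman w x₀) with hd'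
  have ha0 : ∀ k, 0 ≤ a k := fun k => epochMean_nonneg hbn hx₀ hX (fun x hx => H.gap_nonneg hx) k
  have hd0 : ∀ k, 0 ≤ d k := fun k =>
    epochMean_nonneg hbn hx₀ hX (fun x hx => H.mirror_nonneg H.mem hx) k
  have hd0' : ∀ k, 0 ≤ d' k := fun k =>
    epochMean_nonneg hbn hx₀ hX (fun x hx => H.mirror_nonneg hx₀ hx) k
  have hμk : ∀ k, μ * d k ≤ a k := fun k => by
    have := epochMean_mono (h₁ := μ • bregman w xs) hx₀ hX (fun x hx => hμ x hx) k
    rwa [epochMean_smul] at this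
  -- The choice of `c` merges `c d' (k + 1)` with `-(Γ / η) d' (k + 1)` into `-(Γ / η) γ d' (k +
  -- 1)`.
  have hrec : ∀ k, a (k + 1)
      ≤ (1 / η) * ((1 - Γ) * (d k - d (k + 1)) + Γ * (d' k - γ * d' (k + 1)))
        + (Γ * Δ₀ + (Γ / 2 * Δ₀ + D)) := fun k => by
    refine (H.epochMean_succ_le hG hb hbn hB hBn hη hηL hηg hΓ0 hΓ1 hc0 hx₀ hprox hfin hD
      k).trans (le_of_eq ?_)
    simp only [hd, hd', hc]
    ring
  have hsum := geometric_sum_le hγ0 hγ1 hη hΓ0.le hΓ1 ha0 hd0 hd0'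
    (by simp only [hd', epochMean_zero f prox hBn, bregman_self]) (by positivity) hrec K
  have ha00 : a 0 = Δ₀ := epochMean_zero f prox hBn b x₀ _
  have hd00 : d 0 = bregman w xs x₀ := epochMean_zero f prox hBn b x₀ _
  rw [ha00, hd00] at hsum
  set s := ∑ k ∈ Finset.range K, (1 - γ) * γ ^ k * a k with hs
  set t := ∑ k ∈ Finset.range K, (1 - γ) * γ ^ k * d k with ht
  have hw : ∀ k, 0 ≤ (1 - γ) * γ ^ k := fun k => by positivity
  have hs0 : 0 ≤ s := Finset.sum_nonneg fun k _ => mul_nonneg (hw k) (ha0 k)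
  have hts : μ * t ≤ s := by
    rw [ht, Finset.mul_sum]
    refine Finset.sum_le_sum fun k _ => ?_
    rw [mul_left_comm]
    exact mul_le_mul_of_nonneg_left (hμk k) (hw k)
  have hd000 := H.mirror_nonneg H.mem hx₀
  set A := (1 - Γ) * (b / m / η) with hA
  have e1 : (1 - Γ) * ((1 - γ) / η) = γ * A := by rw [hA, hγp]; ring
  have e2 : 4 * b * (1 - Γ) / (3 * η) * (1 / m) = 4 / 3 * A := by rw [hA]; field_simp
  rw [e1] at hsum
  rw [e2]
  have hsγ : γ * s ≤ s := by nlinarith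
  -- Since `1 - γ = γ b / m`, the whole right side carries a factor `γ`, which cancels.
  have h1 : γ * (s + A * t) ≤ γ * (b / m * Δ₀ + A * bregman w xs x₀
      + (Γ * Δ₀ + (Γ / 2 * Δ₀ + D))) := by
    rw [hγp] at hsum
    linarith
  have h2 := le_of_mul_le_mul_left h1 hγ0
  have h3 : b / m * Δ₀ ≤ Γ * Δ₀ :=
    mul_le_mul_of_nonneg_right (by rwa [div_le_iff₀ hm]) hΔ0
  have h4 : 0 ≤ Γ * Δ₀ := by positivity
  -- Write `s ≥ 3s / 4 + μt / 4` and multiply by `4 / 3`. The initial gap gets `4 / 3 * (1 + 1 + 1 /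
  -- 2) = 10 / 3`, at most `4`, times `Γ`.
  linarith

end EpochMean

/-! ### Error of the large batch. -/

section BatchBound

variable {E : Type*} [NormedAddCommGroup E] [InnerProductSpace ℝ E] [CompleteSpace E]
  [MeasurableSpace E] {n : ℕ} {X : Set E} {f : Fin n → E → ℝ} {ψ w : E → ℝ} {xs : E} {G : E → ℝ}
  {L : ℝ} {g : ℝ → ℝ} {CG : ℝ}

/-- The expected error of the large batch. -/
lemma IsProblem.batchErr_le (H : IsProblem X f ψ w xs G L) (hG : IsCHEF G g CG) {B : ℕ}
    (hB : 1 ≤ B) (hBn : B ≤ n) {c l : ℝ} (hc : 0 < c) (hl : 0 < l) (hcl : 3 * L / (B * c) ≤ g l)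
    {x₀ : E} (hx₀ : x₀ ∈ X) (hfin : dH f G L xs ≠ ⊤) :
    (∀ S ∈ Finset.univ.powersetCard B, convexConj G ((1 / c) • batchErr f x₀ S) ≠ ⊤) ∧
      ∑ S ∈ Finset.univ.powersetCard B,
        c * (convexConj G ((1 / c) • batchErr f x₀ S)).toReal
      ≤ (n.choose B : ℝ) * (CG * l
        * (2 * (objective f ψ x₀ - objective f ψ xs) + (dH f G L xs).toReal)) := by
  have hCG := hG.const_pos
  have h := hG.batchNoise_le hB hBn H.pos hc hl hcl
    (fun i => gradient (f i) x₀ - gradient (f i) xs)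
    (fun i => gradient (f i) xs - gradient (avgLoss f) xs) (sum_gradient_sub H H.mem)
    (fun i => bregman (f i) x₀ xs) (fun i => H.loss_nonneg i x₀ xs H.mem)
    (fun i => H.convexConj_gradient_le i hx₀ H.mem) (D := (dH f G L xs).toReal)
    ENNReal.toReal_nonneg (by rw [ENNReal.ofReal_toReal hfin]; exact le_rfl)
  have e : ∀ S ∈ (Finset.univ : Finset (Fin n)).powersetCard B,
      batchNoise (fun i => gradient (f i) x₀ - gradient (f i) xs)
        (fun i => gradient (f i) xs - gradient (avgLoss f) xs) S = batchErr f x₀ S :=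
    fun S hS => batchNoise_eq H hx₀ H.mem (by rw [Finset.mem_powersetCard_univ.1 hS]; omega)
  refine ⟨fun S hS => by rw [← e S hS]; exact h.1 S hS, ?_⟩
  rw [Finset.sum_congr rfl fun S hS => by rw [← e S hS]]
  refine h.2.trans ?_
  rw [← bregman_avgLoss fun i => H.diff_loss i xs H.mem]
  have := H.bregman_le_gap hx₀
  gcongr

end BatchBound

/-! ### The epoch bound from a fixed starting point. -/

section Pointwise

variable {E : Type*} [NormedAddCommGroup E] [InnerProductSpace ℝ E] [CompleteSpace E]
  [MeasurableSpace E] {n : ℕ} {X : Set E} {f : Fin n → E → ℝ} {ψ w : E → ℝ} {xs : E} {G : E → ℝ}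
  {L : ℝ} {g : ℝ → ℝ} {CG : ℝ}

/-- Bounds on all partial sums suffice in `[0, ∞]`, so the truncated epoch bound passes to the full
geometric law. -/
lemma tsum_add_mul_tsum_le {p a d : ℕ → ℝ} {c R : ℝ} (hp : ∀ k, 0 ≤ p k) (ha : ∀ k, 0 ≤ a k)
    (hd : ∀ k, 0 ≤ d k) (hc : 0 ≤ c)
    (h : ∀ K, ∑ k ∈ Finset.range K, p k * a k + c * ∑ k ∈ Finset.range K, p k * d k ≤ R) :
    (∑' k, ENNReal.ofReal (p k) * ENNReal.ofReal (a k))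
        + ENNReal.ofReal c * ∑' k, ENNReal.ofReal (p k) * ENNReal.ofReal (d k)
      ≤ ENNReal.ofReal R := by
  rw [← ENNReal.tsum_mul_left, ← ENNReal.tsum_add]
  refine ENNReal.tsum_le_of_sum_range_le fun K => ?_
  refine le_trans (le_of_eq ?_) (ENNReal.ofReal_le_ofReal (h K))
  rw [Finset.mul_sum, ← Finset.sum_add_distrib, ENNReal.ofReal_sum_of_nonneg]
  · refine Finset.sum_congr rfl fun k _ => ?_
    rw [ENNReal.ofReal_add (mul_nonneg (hp k) (ha k)) (mul_nonneg hc (mul_nonneg (hp k) (hd k))),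
      ENNReal.ofReal_mul hc, ENNReal.ofReal_mul (hp k), ENNReal.ofReal_mul (hp k)]
  · exact fun k _ => add_nonneg (mul_nonneg (hp k) (ha k)) (mul_nonneg hc (mul_nonneg (hp k) (hd k)))

/-- The bound for a single epoch that starts at a fixed point. -/
lemma IsProblem.epoch_tsum_le (H : IsProblem X f ψ w xs G L) (hG : IsCHEF G g CG) {b B : ℕ}
    (hb : 1 ≤ b) (hbn : b ≤ n) (hB : 1 ≤ B) (hBn : B ≤ n) {Γ m μ η α : ℝ} {j : ℕ} (hη : 0 < η)
    (hηL : 6 * η * L ≤ min 1 (b * g (Γ / (3 * CG)))) (hΓ0 : 0 < Γ) (hΓ1 : Γ ≤ 1 / 4)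
    (hα : 1 < α) (hm : max (b : ℝ) (4 * CG * α ^ j) / Γ ≤ m)
    (hBm : 5 / (8 * Γ) * g (Γ / (3 * CG)) * (m / g (1 / m)) ≤ B) (hμ0 : 0 ≤ μ)
    (hμ : ∀ x ∈ X, μ * bregman w xs x ≤ objective f ψ x - objective f ψ xs)
    {prox : E → E → E} {x₀ : E} (hx₀ : x₀ ∈ X)
    (hprox : ∀ S R : Finset (Fin n), S.card = B → R.card = b → ∀ x ∈ X,
      prox (vrGrad f S R x₀ x) x ∈ X ∧
      IsMinOn (proxObjective ψ w η (vrGrad f S R x₀ x) x) X (prox (vrGrad f S R x₀ x) x)) :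
    (∑' k, ENNReal.ofReal ((1 - m / (m + b)) * (m / (m + b)) ^ k)
          * ENNReal.ofReal (epochMean f prox B b x₀ k
              fun y => objective f ψ y - objective f ψ xs))
        + ENNReal.ofReal (4 * b * (1 - Γ) / (3 * η) * (1 / m) + μ / 3)
          * ∑' k, ENNReal.ofReal ((1 - m / (m + b)) * (m / (m + b)) ^ k)
            * ENNReal.ofReal (epochMean f prox B b x₀ k (bregman w xs))
      ≤ ENNReal.ofReal (4 * Γ) * ENNReal.ofReal (objective f ψ x₀ - objective f ψ xs)
        + ENNReal.ofReal (4 * b * (1 - Γ) / (3 * η) * (1 / m)) * ENNReal.ofReal (bregman w xs x₀)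
        + (if B < n then ENNReal.ofReal (1 / (6 * α ^ j)) * dH f G L xs else 0) := by
  have hCG := hG.const_pos
  have hL := H.pos
  have hb' : (0 : ℝ) < b := by exact_mod_cast hb
  have hB' : (0 : ℝ) < B := by exact_mod_cast hB
  have hαj : 1 ≤ α ^ j := one_le_pow₀ hα.le
  obtain ⟨hηL1, hηg⟩ := le_min_iff.1 hηL
  rw [div_le_iff₀ hΓ0] at hm
  obtain ⟨hbm, hCm⟩ := max_le_iff.1 hm
  have hm0 : 0 < m := by
    by_contra hneg
    have : m * Γ ≤ 0 := mul_nonpos_of_nonpos_of_nonneg (not_lt.1 hneg) hΓ0.le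
    linarith
  have hγp : 1 - m / (m + b) = m / (m + b) * (b / m) := by field_simp; ring
  have hγ0 : 0 < m / (m + b) := by positivity
  have hp0 : 0 < 1 - m / (m + b) := by rw [hγp]; positivity
  have hΔ0 := H.gap_nonneg hx₀
  have hd0 := H.mirror_nonneg H.mem hx₀
  set c := Γ * (1 - m / (m + b)) / η with hc
  have hc0 : 0 < c := by positivity
  have hX : ∀ S ∈ Finset.univ.powersetCard B, ∀ R ∈ Finset.univ.powersetCard b, ∀ x ∈ X,
      batchStep f prox S x₀ R x ∈ X := fun S hS R hR x hx =>
    (hprox S R (Finset.mem_powersetCard_univ.1 hS) (Finset.mem_powersetCard_univ.1 hR) x hx).1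
  have hA0 : 0 ≤ 4 * b * (1 - Γ) / (3 * η) * (1 / m) := by
    have : 0 ≤ 1 - Γ := by linarith
    positivity
  have main : ∀ D : ℝ, 0 ≤ D →
      (∀ S ∈ Finset.univ.powersetCard B, convexConj G ((1 / c) • batchErr f x₀ S) ≠ ⊤) →
      ∑ S ∈ Finset.univ.powersetCard B,
        c * (convexConj G ((1 / c) • batchErr f x₀ S)).toReal
        ≤ (n.choose B : ℝ) * (Γ / 2 * (objective f ψ x₀ - objective f ψ xs) + D) →
      _ := fun D hD0 hfin hD =>
    tsum_add_mul_tsum_le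
      (p := fun k => (1 - m / (m + b)) * (m / (m + b)) ^ k)
      (a := fun k => epochMean f prox B b x₀ k fun y => objective f ψ y - objective f ψ xs)
      (d := fun k => epochMean f prox B b x₀ k (bregman w xs))
      (c := 4 * b * (1 - Γ) / (3 * η) * (1 / m) + μ / 3)
      (fun k => by positivity)
      (fun k => epochMean_nonneg hbn hx₀ hX (fun x hx => H.gap_nonneg hx) k)
      (fun k => epochMean_nonneg hbn hx₀ hX (fun x hx => H.mirror_nonneg H.mem hx) k)
      (by positivity)
      (H.epoch_sum_le hG hb hbn hB hBn hη hηL1 hηg hΓ0 (by linarith) hm0 (by linarith) hμ hx₀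
        hprox hc hfin hD0 hD)
  have hR : ∀ D : ℝ, 0 ≤ D → ENNReal.ofReal (4 * Γ * (objective f ψ x₀ - objective f ψ xs)
        + 4 * b * (1 - Γ) / (3 * η) * (1 / m) * bregman w xs x₀ + 4 / 3 * D)
      = ENNReal.ofReal (4 * Γ) * ENNReal.ofReal (objective f ψ x₀ - objective f ψ xs)
        + ENNReal.ofReal (4 * b * (1 - Γ) / (3 * η) * (1 / m)) * ENNReal.ofReal (bregman w xs x₀)
        + ENNReal.ofReal (4 / 3 * D) := fun D hD => by
    rw [ENNReal.ofReal_add (by positivity) (by positivity),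
      ENNReal.ofReal_add (by positivity) (by positivity), ENNReal.ofReal_mul (by positivity),
      ENNReal.ofReal_mul hA0]
  rcases lt_or_eq_of_le hBn with hlt | heq
  · rw [if_pos hlt]
    by_cases htop : dH f G L xs = ⊤
    · rw [htop, ENNReal.mul_top (by simpa using by positivity), add_top]
      exact le_top
    -- Positivity ensures that the division in the batch-size condition is genuine rather than the
    -- default value zero.
    have hgm : 0 < g (1 / m) := hG.g_pos (by positivity)
    have hcl : 3 * L / (B * c) ≤ g (1 / m) := by
      rw [div_le_iff₀ (by positivity)]
      have h1 : 5 / (8 * Γ) * g (Γ / (3 * CG)) * m ≤ B * g (1 / m) := by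
        rw [← mul_div_assoc, div_le_iff₀ hgm] at hBm
        exact hBm
      have h2 : (5 / (8 * Γ) * (6 * η * L) / b) * m ≤ B * g (1 / m) := by
        refine le_trans ?_ h1
        gcongr ?_ * _
        rw [div_le_iff₀ hb', mul_assoc _ _ (b : ℝ), mul_comm _ (b : ℝ)]
        gcongr
      have h3 : g (1 / m) * (B * c) = (B * g (1 / m)) * c := by ring
      rw [h3]
      refine le_trans ?_ (mul_le_mul_of_nonneg_right h2 hc0.le)
      rw [hc, hγp]
      have h4 : 5 / (8 * Γ) * (6 * η * L) / b * m * (Γ * (m / (m + b) * (b / m)) / η)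
          = 15 * L / 4 * (m / (m + b)) := by field_simp; ring
      rw [h4, mul_div_assoc', le_div_iff₀ (by positivity)]
      -- Makes `m / (m + b) ≥ 4 / 5`, so `15L / 4` times it is at least `3L`; the `5 / 8` in the
      -- batch-size condition is tuned to this.
      have : (b : ℝ) ≤ m / 4 := by nlinarith
      nlinarith
    obtain ⟨hfin, hsum⟩ := H.batchErr_le hG hB hBn hc0 (by positivity : 0 < 1 / m) hcl hx₀ htop
    have hCGm : CG * (1 / m) ≤ Γ / (4 * α ^ j) := by
      rw [mul_one_div, div_le_div_iff₀ hm0 (by positivity)]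
      linarith
    have hdH0 : 0 ≤ (dH f G L xs).toReal := ENNReal.toReal_nonneg
    refine (main ((dH f G L xs).toReal * (Γ / (4 * α ^ j))) (by positivity) hfin
      (hsum.trans ?_)).trans ?_
    · refine mul_le_mul_of_nonneg_left ?_ (by positivity)
      have h5 : Γ / (4 * α ^ j) ≤ Γ / 4 := by
        rw [div_le_div_iff₀ (by positivity) (by positivity)]
        nlinarith
      have h6 := mul_le_mul_of_nonneg_right hCGm hdH0
      have h7 := mul_le_mul_of_nonneg_right (hCGm.trans h5) hΔ0
      linarith
    · rw [hR _ (by positivity)]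
      gcongr
      rw [← ENNReal.ofReal_toReal htop, ENNReal.toReal_ofReal hdH0,
        ← ENNReal.ofReal_mul (by positivity)]
      apply ENNReal.ofReal_le_ofReal
      have h8 : 4 / 3 * ((dH f G L xs).toReal * (Γ / (4 * α ^ j)))
          = (Γ / 3 / α ^ j) * (dH f G L xs).toReal := by field_simp
      rw [h8]
      refine mul_le_mul_of_nonneg_right ?_ hdH0
      rw [div_le_div_iff₀ (by positivity) (by positivity)]
      nlinarith
  · rw [if_neg (by omega)]
    -- With the full batch the error vanishes, so `D_H` may even be infinite.
    have huniv : ∀ S ∈ (Finset.univ : Finset (Fin n)).powersetCard B, batchErr f x₀ S = 0 := by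
      intro S hS
      have : S = Finset.univ := by
        rw [← Finset.card_eq_iff_eq_univ, Finset.mem_powersetCard_univ.1 hS, heq, Fintype.card_fin]
      rw [this, batchErr_univ H hx₀]
    have h0 : ∀ S ∈ (Finset.univ : Finset (Fin n)).powersetCard B,
        convexConj G ((1 / c) • batchErr f x₀ S) = 0 := fun S hS => by
      rw [huniv S hS, smul_zero, convexConj_zero hG.nonneg]
    refine (main 0 le_rfl (fun S hS => by rw [h0 S hS]; exact ENNReal.zero_ne_top) ?_).trans ?_
    · rw [Finset.sum_congr rfl fun S hS => by rw [h0 S hS]]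
      simp only [ENNReal.toReal_zero, mul_zero, Finset.sum_const_zero, add_zero]
      positivity
    · rw [hR 0 le_rfl]
      simp

end Pointwise

/-! ### Expectations as sums over sample realizations. -/

section Realizations

/-- The probability that a uniformly random batch of size `b` equals `R`. -/
noncomputable def batchWeight {n : ℕ} (b : ℕ) (R : Finset (Fin n)) : ℝ :=
  if R.card = b then 1 / (n.choose b : ℝ) else 0

lemma batchWeight_nonneg {n : ℕ} (b : ℕ) (R : Finset (Fin n)) : 0 ≤ batchWeight b R := by
  unfold batchWeight
  split_ifs <;> positivity

lemma ofReal_batchWeight {n b : ℕ} (hb : b ≤ n) (R : Finset (Fin n)) :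
    ENNReal.ofReal (batchWeight b R)
      = if R.card = b then ((n.choose b : ℕ) : ℝ≥0∞)⁻¹ else 0 := by
  have : (0 : ℝ) < n.choose b := by exact_mod_cast Nat.choose_pos hb
  unfold batchWeight
  split_ifs
  · rw [one_div, ENNReal.ofReal_inv_of_pos this, ENNReal.ofReal_natCast]
  · simp

lemma sum_powersetCard_eq_sum_batchWeight {n : ℕ} (b : ℕ) (h : Finset (Fin n) → ℝ) :
    (1 / (n.choose b : ℝ)) * ∑ R ∈ Finset.univ.powersetCard b, h R
      = ∑ R, batchWeight b R * h R := by
  rw [Finset.powersetCard_eq_filter, Finset.powerset_univ, Finset.sum_filter, Finset.mul_sum]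
  refine Finset.sum_congr rfl fun R _ => ?_
  unfold batchWeight
  split_ifs <;> simp

/-- The sequence that starts with the entries of a tuple of batches. -/
def extendTuple {n k : ℕ} (r : Fin k → Finset (Fin n)) (i : ℕ) : Finset (Fin n) :=
  if h : i < k then r ⟨i, h⟩ else ∅

variable {E : Type*} [NormedAddCommGroup E] [InnerProductSpace ℝ E] [CompleteSpace E]
  {n : ℕ} {f : Fin n → E → ℝ}

lemma innerIter_congr (prox : E → E → E) (x₀ : E) (S : Finset (Fin n))
    {J J' : ℕ → Finset (Fin n)} {k : ℕ} (h : ∀ i < k, J i = J' i) :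
    innerIter f prox x₀ S J k = innerIter f prox x₀ S J' k := by
  induction k with
  | zero => rfl
  | succ k ih =>
    simp only [innerIter]
    rw [ih fun i hi => h i (by omega), h k (by omega)]

lemma outerIter_congr (prox : ℕ → E → E → E) (x₀ : E) {I I' : ℕ → Finset (Fin n)} {N N' : ℕ → ℕ}
    {J J' : ℕ → ℕ → Finset (Fin n)} {j : ℕ} (hI : ∀ i ∈ Set.Icc 1 j, I i = I' i)
    (hN : ∀ i ∈ Set.Icc 1 j, N i = N' i)
    (hJ : ∀ i ∈ Set.Icc 1 j, ∀ k < N i, J i k = J' i k) :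
    outerIter f prox x₀ I N J j = outerIter f prox x₀ I' N' J' j := by
  induction j with
  | zero => rfl
  | succ j ih =>
    have hj : j + 1 ∈ Set.Icc 1 (j + 1) := ⟨by omega, le_rfl⟩
    have hs : ∀ i ∈ Set.Icc 1 j, i ∈ Set.Icc 1 (j + 1) := fun i hi => ⟨hi.1, by have := hi.2; omega⟩
    simp only [outerIter]
    rw [ih (fun i hi => hI i (hs i hi)) (fun i hi => hN i (hs i hi))
      (fun i hi => hJ i (hs i hi)), hI _ hj, ← hN _ hj]
    exact innerIter_congr _ _ _ (hJ _ hj)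

/-- Unfolds the Markov operator into paths. The operator acting first on `h` is the last step, so
the induction appends a mini-batch at the end of the tuple. -/
lemma stepMean_pow_eq_sum (prox : E → E → E) (b : ℕ) (S : Finset (Fin n)) (x₀ : E) (k : ℕ)
    (h : E → ℝ) :
    (stepMean b (batchStep f prox S x₀) ^ k) h x₀
      = ∑ r : Fin k → Finset (Fin n), (∏ i, batchWeight b (r i))
        * h (innerIter f prox x₀ S (extendTuple r) k) := by
  induction k generalizing h with
  | zero => simp [innerIter]
  | succ k ih =>
    rw [pow_succ, Module.End.mul_apply, ih,
      ← (Fin.snocEquiv fun _ : Fin (k + 1) => Finset (Fin n)).sum_comp, Fintype.sum_prod_type_right]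
    refine Finset.sum_congr rfl fun r _ => ?_
    rw [stepMean_apply, sum_powersetCard_eq_sum_batchWeight, Finset.mul_sum]
    refine Finset.sum_congr rfl fun R _ => ?_
    rw [Fin.prod_univ_castSucc]
    simp only [Fin.snocEquiv, Equiv.coe_fn_mk, Fin.snoc_castSucc, Fin.snoc_last, innerIter]
    have e1 : innerIter f prox x₀ S
        (extendTuple (Fin.snoc (α := fun _ => Finset (Fin n)) r R)) k
        = innerIter f prox x₀ S (extendTuple r) k := by
      refine innerIter_congr _ _ _ fun i hi => ?_
      rw [extendTuple, extendTuple, dif_pos hi, dif_pos (by omega)]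
      exact Fin.snoc_castSucc (α := fun _ => Finset (Fin n)) (i := ⟨i, hi⟩) ..
    have e2 : extendTuple (Fin.snoc (α := fun _ => Finset (Fin n)) r R) k = R := by
      rw [extendTuple, dif_pos (by omega)]
      exact Fin.snoc_last (α := fun _ => Finset (Fin n)) ..
    rw [e1, e2, mul_assoc]
    rfl

/-- A batch of size `b`, equal to `S` if `S` has size `b`, whenever there is one. -/
noncomputable def fixCard {n : ℕ} (b : ℕ) (S : Finset (Fin n)) : Finset (Fin n) :=
  open Classical in
  if h : S.card ≠ b ∧ ∃ T : Finset (Fin n), T.card = b then h.2.choose else S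

lemma fixCard_of_card_eq {b : ℕ} {S : Finset (Fin n)} (h : S.card = b) : fixCard b S = S := by
  unfold fixCard
  rw [dif_neg (by simp [h])]

lemma card_fixCard {b : ℕ} (hb : b ≤ n) (S : Finset (Fin n)) : (fixCard b S).card = b := by
  unfold fixCard
  split_ifs with h
  · exact h.2.choose_spec
  · by_contra hS
    obtain ⟨T, -, hT⟩ := Finset.exists_subset_card_eq (s := (Finset.univ : Finset (Fin n)))
      (n := b) (by simpa using hb)
    exact h ⟨hS, T, hT⟩

/-- The realizations of the samples that are used in one epoch. -/
abbrev EpochSample (n : ℕ) : Type := Finset (Fin n) × (Σ k : ℕ, Fin k → Finset (Fin n))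

/-- The law of the samples that are used in one epoch. -/
noncomputable def sampleWeight {n : ℕ} (B b : ℕ) (p : ℕ → ℝ) (c : EpochSample n) : ℝ≥0∞ :=
  ENNReal.ofReal (batchWeight B c.1) * (ENNReal.ofReal (p c.2.1)
    * ∏ i, ENNReal.ofReal (batchWeight b (c.2.2 i)))

/-- The end point of an epoch for given samples, corrected to the right batch sizes. -/
noncomputable def epochEnd (f : Fin n → E → ℝ) (prox : E → E → E) (B b : ℕ) (x₀ : E)
    (c : EpochSample n) : E :=
  innerIter f prox x₀ (fixCard B c.1) (fun k => fixCard b (extendTuple c.2.2 k)) c.2.1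

lemma innerIter_mem {prox : E → E → E} {X : Set E} {x₀ : E} (hx₀ : x₀ ∈ X)
    {S : Finset (Fin n)} {J : ℕ → Finset (Fin n)}
    (h : ∀ k, ∀ x ∈ X, prox (vrGrad f S (J k) x₀ x) x ∈ X) (k : ℕ) :
    innerIter f prox x₀ S J k ∈ X := by
  induction k with
  | zero => exact hx₀
  | succ k ih => exact h k _ ih

/-- Realizations with a wrong batch size have weight zero, so correcting the sizes changes no term
while keeping every end point in `X`. -/
lemma tsum_sampleWeight_mul {prox : E → E → E} {X : Set E} {B b : ℕ} (hB : B ≤ n) (hb : b ≤ n)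
    {x₀ : E} (hx₀ : x₀ ∈ X)
    (hprox : ∀ S R : Finset (Fin n), S.card = B → R.card = b → ∀ x ∈ X,
      prox (vrGrad f S R x₀ x) x ∈ X) (p : ℕ → ℝ)
    {h : E → ℝ} (hh : ∀ x ∈ X, 0 ≤ h x) :
    ∑' c : EpochSample n, sampleWeight B b p c * ENNReal.ofReal (h (epochEnd f prox B b x₀ c))
      = ∑' k, ENNReal.ofReal (p k) * ENNReal.ofReal (epochMean f prox B b x₀ k h) := by
  have hend : ∀ c, 0 ≤ h (epochEnd f prox B b x₀ c) := fun c =>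
    hh _ (innerIter_mem hx₀ (fun k => hprox _ _ (card_fixCard hB _) (card_fixCard hb _)) _)
  rw [ENNReal.tsum_prod', ENNReal.tsum_comm, ENNReal.tsum_sigma']
  refine tsum_congr fun k => ?_
  simp only [tsum_fintype]
  have hM : epochMean f prox B b x₀ k h = ∑ r : Fin k → Finset (Fin n), ∑ S,
      batchWeight B S * ((∏ i, batchWeight b (r i))
        * h (epochEnd f prox B b x₀ (S, ⟨k, r⟩))) := by
    rw [epochMean, sum_powersetCard_eq_sum_batchWeight, Finset.sum_comm]
    refine Finset.sum_congr rfl fun S _ => ?_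
    rw [stepMean_pow_eq_sum, Finset.mul_sum]
    refine Finset.sum_congr rfl fun r _ => ?_
    by_cases hS : S.card = B
    · by_cases hr : ∀ i, (r i).card = b
      · rw [epochEnd, fixCard_of_card_eq hS]
        have e : innerIter f prox x₀ S (extendTuple r) k
            = innerIter f prox x₀ S (fun i => fixCard b (extendTuple r i)) k := by
          refine innerIter_congr _ _ _ fun i hi => ?_
          rw [fixCard_of_card_eq]
          simpa [extendTuple, hi] using hr ⟨i, hi⟩
        rw [e]
      · obtain ⟨i, hi⟩ := not_forall.1 hr
        rw [Finset.prod_eq_zero (Finset.mem_univ i) (by rw [batchWeight, if_neg hi])]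
        simp
    · simp [batchWeight, hS]
  have hw : ∀ (r : Fin k → Finset (Fin n)) (S : Finset (Fin n)),
      0 ≤ batchWeight B S * ((∏ i, batchWeight b (r i))
        * h (epochEnd f prox B b x₀ (S, ⟨k, r⟩))) := fun r S =>
    mul_nonneg (batchWeight_nonneg _ _)
      (mul_nonneg (Finset.prod_nonneg fun i _ => batchWeight_nonneg _ _) (hend _))
  rw [hM, ENNReal.ofReal_sum_of_nonneg fun r _ => Finset.sum_nonneg fun S _ => hw r S,
    Finset.mul_sum]
  refine Finset.sum_congr rfl fun r _ => ?_
  rw [ENNReal.ofReal_sum_of_nonneg fun S _ => hw r S, Finset.mul_sum]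
  refine Finset.sum_congr rfl fun S _ => ?_
  rw [ENNReal.ofReal_mul (batchWeight_nonneg _ _),
    ENNReal.ofReal_mul (Finset.prod_nonneg fun i _ => batchWeight_nonneg _ _),
    ENNReal.ofReal_prod_of_nonneg fun i _ => batchWeight_nonneg _ _]
  simp only [sampleWeight]
  ring

end Realizations

/-! ### Gluing countably many measurable pieces. -/

section Measurability

lemma comap_top_le {Ω ι : Type*} [Countable ι] {m : MeasurableSpace Ω} (u : Ω → ι)
    (hu : ∀ a, MeasurableSet {ω | u ω = a}) : MeasurableSpace.comap u ⊤ ≤ m := by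
  rintro _ ⟨t, -, rfl⟩
  have : u ⁻¹' t = ⋃ a ∈ t, {ω | u ω = a} := by ext; simp
  rw [this]
  exact MeasurableSet.biUnion (Set.to_countable t) fun a _ => hu a

lemma measurable_of_countable_family {Ω ι β : Type*} [Countable ι] [MeasurableSpace β]
    {m : MeasurableSpace Ω} {κ : Ω → ι} (hκ : ∀ c, MeasurableSet {ω | κ ω = c})
    {Φ : ι → Ω → β} (hΦ : ∀ c, Measurable (Φ c)) : Measurable fun ω => Φ (κ ω) ω := by
  intro s hs
  have : (fun ω => Φ (κ ω) ω) ⁻¹' s = ⋃ c, {ω | κ ω = c} ∩ Φ c ⁻¹' s := by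
    ext; simp
  rw [this]
  exact MeasurableSet.iUnion fun c => (hκ c).inter (hΦ c hs)

end Measurability

/-- The epoch to which a source of randomness belongs; the initial point belongs to epoch zero. -/
def Source.epoch : Source → ℕ
  | .initial => 0
  | .batch j => j
  | .steps j => j
  | .mini j _ => j

/-- The samples that are used in epoch `i`. -/
def epochSample {Ω : Type*} {n : ℕ} (I : ℕ → Ω → Finset (Fin n)) (N : ℕ → Ω → ℕ)
    (J : ℕ → ℕ → Ω → Finset (Fin n)) (ω : Ω) (i : ℕ) : EpochSample n :=
  (I i ω, ⟨N i ω, fun k => J i k ω⟩)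

/-- The outer iterates for given samples, corrected to the right batch sizes. -/
noncomputable def sampleIter {E : Type*} [NormedAddCommGroup E] [InnerProductSpace ℝ E]
    [CompleteSpace E] {n : ℕ} (f : Fin n → E → ℝ) (prox : ℕ → E → E → E) (B b : ℕ → ℕ) (x₀ : E)
    (C : ℕ → EpochSample n) (j : ℕ) : E :=
  outerIter f prox x₀ (fun i => fixCard (B i) (C i).1) (fun i => (C i).2.1)
    (fun i k => fixCard (b i) (extendTuple (C i).2.2 k)) j

/-! ### Events determined by the samples of one epoch. -/

section Samples

variable {Ω E : Type*} {n : ℕ} {X₀ : Ω → E} {I : ℕ → Ω → Finset (Fin n)} {N : ℕ → Ω → ℕ}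
  {J : ℕ → ℕ → Ω → Finset (Fin n)}

lemma setOf_epochSample_eq (i : ℕ) (c : EpochSample n) :
    {ω | epochSample I N J ω i = c} = {ω | I i ω = c.1} ∩ {ω | N i ω = c.2.1}
      ∩ ⋂ k ∈ Finset.range c.2.1, {ω | J i k ω = extendTuple c.2.2 k} := by
  obtain ⟨S, K, r⟩ := c
  ext ω
  simp only [epochSample, Set.mem_ofPred_eq, Prod.mk.injEq, Set.mem_inter_iff, Set.mem_iInter,
    Finset.mem_range]
  constructor
  · rintro ⟨h1, h2⟩
    obtain ⟨rfl, h3⟩ := Sigma.mk.inj_iff.1 h2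
    refine ⟨⟨h1, rfl⟩, fun k hk => ?_⟩
    rw [extendTuple, dif_pos hk, ← eq_of_heq h3]
  · rintro ⟨⟨h1, rfl⟩, h2⟩
    refine ⟨h1, Sigma.mk.inj_iff.2 ⟨rfl, heq_of_eq (funext fun k => ?_)⟩⟩
    rw [h2 k k.2, extendTuple, dif_pos k.2]

lemma measurableSet_epochSample [MeasurableSpace E] {F : MeasurableSpace Ω} {i : ℕ}
    (hF : ∀ s : Source, s.epoch = i → sourceSigma X₀ I N J s ≤ F) (c : EpochSample n) :
    MeasurableSet[F] {ω | epochSample I N J ω i = c} := by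
  rw [setOf_epochSample_eq]
  refine MeasurableSet.inter (MeasurableSet.inter ?_ ?_)
    (Finset.measurableSet_biInter _ fun k _ => ?_)
  · exact hF (.batch i) rfl _ ⟨{c.1}, trivial, rfl⟩
  · exact hF (.steps i) rfl _ ⟨{c.2.1}, trivial, rfl⟩
  · exact hF (.mini i k) rfl _ ⟨{extendTuple c.2.2 k}, trivial, rfl⟩

end Samples

/-! ### Law, measurability and conditioning of the random run. -/

section Run

variable {Ω E : Type*} [mΩ : MeasurableSpace Ω] {P : Measure Ω}
  [NormedAddCommGroup E] [InnerProductSpace ℝ E] [CompleteSpace E]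
  {n : ℕ} {X : Set E} {f : Fin n → E → ℝ} {ψ w : E → ℝ} {xs : E} {T : ℕ} {η m : ℕ → ℝ}
  {B b : ℕ → ℕ} {prox : ℕ → E → E → E} {X₀ : Ω → E} {I : ℕ → Ω → Finset (Fin n)} {N : ℕ → Ω → ℕ}
  {J : ℕ → ℕ → Ω → Finset (Fin n)}

lemma sampleIter_congr (x₀ : E) {C C' : ℕ → EpochSample n} {j : ℕ}
    (h : ∀ i ∈ Set.Icc 1 j, C i = C' i) :
    sampleIter f prox B b x₀ C j = sampleIter f prox B b x₀ C' j :=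
  outerIter_congr _ _ (fun i hi => by rw [h i hi]) (fun i hi => by rw [h i hi])
    fun i hi k _ => by rw [h i hi]

lemma sampleIter_succ (x₀ : E) (C : ℕ → EpochSample n) (j : ℕ) :
    sampleIter f prox B b x₀ C (j + 1) = epochEnd f (prox (j + 1)) (B (j + 1)) (b (j + 1))
      (sampleIter f prox B b x₀ C j) (C (j + 1)) := rfl

variable [MeasurableSpace E]

/-- A function of the iterates that is measurable for fixed samples. -/
def IsSampleMeasurable (f : Fin n → E → ℝ) (prox : ℕ → E → E → E) (T : ℕ) (B b : ℕ → ℕ) (X₀ : Ω → E)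
    (h : E → ℝ) : Prop :=
  ∀ (I' : ℕ → Finset (Fin n)) (N' : ℕ → ℕ) (J' : ℕ → ℕ → Finset (Fin n)),
    (∀ j ∈ Set.Icc 1 T, (I' j).card = B j) → (∀ j ∈ Set.Icc 1 T, ∀ k, (J' j k).card = b j) →
    ∀ j ≤ T, Measurable[MeasurableSpace.comap X₀ inferInstance]
      (fun ω => h (outerIter f prox (X₀ ω) I' N' J' j))

variable (hrun : IsRun P X f ψ w xs T η m B b prox X₀ I N J)
include hrun

lemma IsRun.sourceSigma_le (s : Source) : sourceSigma X₀ I N J s ≤ mΩ := by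
  cases s with
  | initial => exact hrun.init_meas.comap_le
  | batch j => exact comap_top_le _ (hrun.batch_meas j)
  | steps j => exact comap_top_le _ (hrun.steps_meas j)
  | mini j k => exact comap_top_le _ (hrun.mini_meas j k)

/-- The law of the samples that are used in one epoch. -/
lemma IsRun.measure_epochSample {j : ℕ} (hj : j ∈ Set.Icc 1 T) (c : EpochSample n) :
    P {ω | epochSample I N J ω j = c} = sampleWeight (B j) (b j)
      (fun k => (1 - m j / (m j + b j)) * (m j / (m j + b j)) ^ k) c := by
  classical
  let s : Source → Set Ω := fun
    | .initial => Set.univ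
    | .batch i => {ω | I i ω = c.1}
    | .steps i => {ω | N i ω = c.2.1}
    | .mini i k => {ω | J i k ω = extendTuple c.2.2 k}
  let F : Finset Source := insert (.batch j) (insert (.steps j)
    ((Finset.range c.2.1).image (Source.mini j)))
  have hs : ∀ i ∈ F, MeasurableSet[sourceSigma X₀ I N J i] (s i) := fun i _ => by
    cases i with
    | initial => exact MeasurableSet.univ
    | batch i => exact ⟨{c.1}, trivial, rfl⟩
    | steps i => exact ⟨{c.2.1}, trivial, rfl⟩
    | mini i k => exact ⟨{extendTuple c.2.2 k}, trivial, rfl⟩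
  have h := hrun.indep.meas_biInter (S := F) hs
  have e1 : ⋂ i ∈ F, s i = {ω | epochSample I N J ω j = c} := by
    rw [setOf_epochSample_eq]
    simp [F, s, Set.inter_assoc]
  rw [e1] at h
  rw [h, Finset.prod_insert (by simp), Finset.prod_insert (by simp),
    Finset.prod_image (by intro a _ a' _ h; simpa using h)]
  simp only [s, sampleWeight, hrun.batch_law j hj, hrun.steps_law j hj, hrun.mini_law j hj,
    ofReal_batchWeight (hrun.batch_size j hj).2, ofReal_batchWeight (hrun.mini_size j hj).2]
  rw [Finset.prod_range]
  congr 2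
  refine Finset.prod_congr rfl fun k _ => ?_
  rw [extendTuple, dif_pos k.2]

lemma IsRun.ae_card : ∀ᵐ ω ∂P, ∀ i ∈ Set.Icc 1 T,
    (I i ω).card = B i ∧ ∀ k, (J i k ω).card = b i := by
  rw [ae_all_iff]
  intro i
  rw [ae_all_iff]
  intro hi
  have hI : ∀ᵐ ω ∂P, ∀ S : Finset (Fin n), S.card ≠ B i → I i ω ≠ S := by
    refine ae_all_iff.2 fun S => ae_all_iff.2 fun hS => ?_
    rw [ae_iff]
    simpa [hS] using hrun.batch_law i hi S
  have hJ : ∀ᵐ ω ∂P, ∀ k, ∀ S : Finset (Fin n), S.card ≠ b i → J i k ω ≠ S := by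
    refine ae_all_iff.2 fun k => ae_all_iff.2 fun S => ae_all_iff.2 fun hS => ?_
    rw [ae_iff]
    simpa [hS] using hrun.mini_law i hi k S
  filter_upwards [hI, hJ] with ω h1 h2
  refine ⟨?_, fun k => ?_⟩
  · by_contra h
    exact h1 _ h rfl
  · by_contra h
    exact h2 k _ h rfl

lemma IsRun.ae_iterate_eq : ∀ᵐ ω ∂P, ∀ j ≤ T, iterate f prox X₀ I N J j ω
    = sampleIter f prox B b (X₀ ω) (epochSample I N J ω) j := by
  filter_upwards [hrun.ae_card] with ω hω j hj
  have hs : ∀ i ∈ Set.Icc 1 j, i ∈ Set.Icc 1 T := fun i hi => ⟨hi.1, hi.2.trans hj⟩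
  refine outerIter_congr _ _ (fun i hi => ?_) (fun i hi => rfl) fun i hi k hk => ?_
  · exact (fixCard_of_card_eq (hω i (hs i hi)).1).symm
  · have e : extendTuple (epochSample I N J ω i).2.2 k = J i k ω := by
      rw [extendTuple, dif_pos (by exact hk)]
      rfl
    simp only [e]
    exact (fixCard_of_card_eq ((hω i (hs i hi)).2 k)).symm

lemma IsRun.sampleIter_mem (ω : Ω) (C : ℕ → EpochSample n) {j : ℕ} (hj : j ≤ T) :
    sampleIter f prox B b (X₀ ω) C j ∈ X := by
  induction j with
  | zero => exact hrun.init_mem ω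
  | succ j ih =>
    have hj' : j + 1 ∈ Set.Icc 1 T := ⟨by omega, hj⟩
    exact innerIter_mem (ih (by omega)) (fun k x hx => (hrun.prox_mem (j + 1) hj' _ _
      (card_fixCard (hrun.batch_size _ hj').2 _) (card_fixCard (hrun.mini_size _ hj').2 _)
      _ (ih (by omega)) x hx).1) _

/-- Once the samples up to epoch `p` are fixed, only the initial point is random; there are
countably many such choices, so no joint measurability of the proximal map is needed. Later epochs
use the constants `C₀`. -/
lemma IsRun.measurable_sampleIter {h : E → ℝ} (hh : IsSampleMeasurable f prox T B b X₀ h)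
    (C₀ : ℕ → EpochSample n) (p : ℕ) {q : ℕ} (hq : q ≤ T) :
    Measurable[⨆ s ∈ {s : Source | s.epoch ≤ p}, sourceSigma X₀ I N J s]
      (fun ω => h (sampleIter f prox B b (X₀ ω)
        (fun i => if i ≤ p then epochSample I N J ω i else C₀ i) q)) := by
  have hle : ∀ s : Source, s.epoch ≤ p → sourceSigma X₀ I N J s
      ≤ ⨆ s ∈ {s : Source | s.epoch ≤ p}, sourceSigma X₀ I N J s := fun s hs =>
    le_iSup₂ (f := fun (s : Source) (_ : s ∈ {s : Source | s.epoch ≤ p}) =>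
      sourceSigma X₀ I N J s) s hs
  have hB : ∀ j ∈ Set.Icc 1 T, B j ≤ n := fun j hj => (hrun.batch_size j hj).2
  have hb : ∀ j ∈ Set.Icc 1 T, b j ≤ n := fun j hj => (hrun.mini_size j hj).2
  generalize (⨆ s ∈ {s : Source | s.epoch ≤ p}, sourceSigma X₀ I N J s) = F at hle ⊢
  have hκ : ∀ c : Fin (p + 1) → EpochSample n,
      MeasurableSet[F] {ω | (fun i : Fin (p + 1) => epochSample I N J ω i) = c} := fun c => by
    have e : {ω | (fun i : Fin (p + 1) => epochSample I N J ω i) = c}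
        = ⋂ i : Fin (p + 1), {ω | epochSample I N J ω i = c i} := by
      ext ω; simp [funext_iff]
    rw [e]
    exact MeasurableSet.iInter fun i => measurableSet_epochSample
      (fun s hs => hle s (by have := i.2; omega)) (c i)
  let C : (Fin (p + 1) → EpochSample n) → ℕ → EpochSample n := fun c i =>
    if hi : i ≤ p then c ⟨i, by omega⟩ else C₀ i
  have hΦ : ∀ c, Measurable[F] fun ω => h (sampleIter f prox B b (X₀ ω) (C c) q) :=
    fun c s hs => hle .initial (Nat.zero_le _) _
      (hh _ _ _ (fun j hj => card_fixCard (hB j hj) (C c j).1)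
        (fun j hj k => card_fixCard (hb j hj) (extendTuple (C c j).2.2 k)) q hq hs)
  exact measurable_of_countable_family hκ hΦ

lemma IsRun.measurable_sampleIter_self {h : E → ℝ} (hh : IsSampleMeasurable f prox T B b X₀ h) {p : ℕ}
    (hp : p ≤ T) : Measurable[⨆ s ∈ {s : Source | s.epoch ≤ p}, sourceSigma X₀ I N J s]
      (fun ω => h (sampleIter f prox B b (X₀ ω) (epochSample I N J ω) p)) := by
  convert hrun.measurable_sampleIter hh (fun _ => (∅, ⟨0, fun _ => ∅⟩)) p hp using 3 with ω
  exact sampleIter_congr _ fun i hi => (if_pos hi.2).symm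

lemma IsRun.measurable_epochEnd {h : E → ℝ} (hh : IsSampleMeasurable f prox T B b X₀ h) {p : ℕ}
    (hp : p + 1 ≤ T) (c : EpochSample n) :
    Measurable[⨆ s ∈ {s : Source | s.epoch ≤ p}, sourceSigma X₀ I N J s]
      (fun ω => h (epochEnd f (prox (p + 1)) (B (p + 1)) (b (p + 1))
        (sampleIter f prox B b (X₀ ω) (epochSample I N J ω) p) c)) := by
  -- Taking `C₀ = c` freezes the sample of epoch `p + 1` while the earlier ones stay random.
  convert hrun.measurable_sampleIter hh (fun _ => c) p hp using 3 with ω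
  rw [sampleIter_succ, if_neg (by omega)]
  congr 1
  exact sampleIter_congr _ fun i hi => (if_pos hi.2).symm

/-- Conditional expectation over the samples of one epoch. -/
lemma IsRun.lintegral_sampleIter_succ {h : E → ℝ} (hh : IsSampleMeasurable f prox T B b X₀ h)
    (h0 : ∀ x ∈ X, 0 ≤ h x) {p : ℕ} (hp : p + 1 ≤ T) :
    Measurable (fun ω => ∑' k, ENNReal.ofReal ((1 - m (p + 1) / (m (p + 1) + b (p + 1)))
        * (m (p + 1) / (m (p + 1) + b (p + 1))) ^ k)
      * ENNReal.ofReal (epochMean f (prox (p + 1)) (B (p + 1)) (b (p + 1))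
        (sampleIter f prox B b (X₀ ω) (epochSample I N J ω) p) k h)) ∧
    ∫⁻ ω, ENNReal.ofReal (h (sampleIter f prox B b (X₀ ω) (epochSample I N J ω) (p + 1))) ∂P
      = ∫⁻ ω, ∑' k, ENNReal.ofReal ((1 - m (p + 1) / (m (p + 1) + b (p + 1)))
        * (m (p + 1) / (m (p + 1) + b (p + 1))) ^ k)
      * ENNReal.ofReal (epochMean f (prox (p + 1)) (B (p + 1)) (b (p + 1))
        (sampleIter f prox B b (X₀ ω) (epochSample I N J ω) p) k h) ∂P := by
  have hp' : p + 1 ∈ Set.Icc 1 T := ⟨by omega, hp⟩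
  have hF : (⨆ s ∈ {s : Source | s.epoch ≤ p}, sourceSigma X₀ I N J s) ≤ mΩ :=
    iSup₂_le fun s _ => hrun.sourceSigma_le s
  have hF' : (⨆ s ∈ {s : Source | s.epoch = p + 1}, sourceSigma X₀ I N J s) ≤ mΩ :=
    iSup₂_le fun s _ => hrun.sourceSigma_le s
  have hind : Indep (⨆ s ∈ {s : Source | s.epoch ≤ p}, sourceSigma X₀ I N J s)
      (⨆ s ∈ {s : Source | s.epoch = p + 1}, sourceSigma X₀ I N J s) P :=
    indep_iSup_of_disjoint hrun.sourceSigma_le hrun.indep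
      (Set.disjoint_left.2 fun s h1 h2 => by
        simp only [Set.mem_ofPred_eq] at h1 h2
        omega)
  let A : EpochSample n → Set Ω := fun c => {ω | epochSample I N J ω (p + 1) = c}
  have hA' : ∀ c, MeasurableSet[⨆ s ∈ {s : Source | s.epoch = p + 1},
      sourceSigma X₀ I N J s] (A c) := fun c =>
    measurableSet_epochSample (fun s hs =>
      le_iSup₂ (f := fun (s : Source) (_ : s ∈ {s : Source | s.epoch = p + 1}) =>
        sourceSigma X₀ I N J s) s hs) c
  have hA : ∀ c, MeasurableSet (A c) := fun c => hF' _ (hA' c)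
  let Φ : EpochSample n → Ω → ℝ≥0∞ := fun c ω =>
    ENNReal.ofReal (h (epochEnd f (prox (p + 1)) (B (p + 1)) (b (p + 1))
      (sampleIter f prox B b (X₀ ω) (epochSample I N J ω) p) c))
  have hΦ' : ∀ c, Measurable[⨆ s ∈ {s : Source | s.epoch ≤ p}, sourceSigma X₀ I N J s] (Φ c) :=
    fun c => ENNReal.measurable_ofReal.comp (hrun.measurable_epochEnd hh hp c)
  have hΦ : ∀ c, Measurable (Φ c) := fun c => (hΦ' c).mono hF le_rfl
  have hpt : ∀ ω, _ := fun ω => tsum_sampleWeight_mul (f := f) (prox := prox (p + 1))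
    (hrun.batch_size _ hp').2 (hrun.mini_size _ hp').2
    (hrun.sampleIter_mem ω (epochSample I N J ω) (j := p) (by omega))
    (fun S R hS hR x hx => (hrun.prox_mem _ hp' S R hS hR _
      (hrun.sampleIter_mem ω (epochSample I N J ω) (j := p) (by omega)) x hx).1)
    (fun k => (1 - m (p + 1) / (m (p + 1) + b (p + 1)))
        * (m (p + 1) / (m (p + 1) + b (p + 1))) ^ k) h0
  simp_rw [← hpt]
  refine ⟨Measurable.tsum fun c => (hΦ c).const_mul _, ?_⟩
  rw [lintegral_tsum fun c => ((hΦ c).const_mul _).aemeasurable]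
  have hU : ⋃ c, A c = Set.univ := by ext ω; simp [A]
  have hdisj : Pairwise (Function.onFun Disjoint A) := fun c c' hcc => by
    refine Set.disjoint_left.2 fun ω h1 h2 => hcc ?_
    exact (h1 : _ = _).symm.trans h2
  -- The space is partitioned by the sample of epoch `p + 1`. On each piece the integrand depends
  -- only on the past, which is independent of the piece.
  rw [← setLIntegral_univ, ← hU, lintegral_iUnion hA hdisj]
  refine tsum_congr fun c => ?_
  rw [lintegral_const_mul _ (hΦ c), ← hrun.measure_epochSample hp' c]
  have h1 : ∫⁻ ω in A c, ENNReal.ofReal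
      (h (sampleIter f prox B b (X₀ ω) (epochSample I N J ω) (p + 1))) ∂P
      = ∫⁻ ω in A c, Φ c ω ∂P := by
    refine setLIntegral_congr_fun (hA c) fun ω hω => ?_
    have hω' : epochSample I N J ω (p + 1) = c := hω
    simp only [Φ, sampleIter_succ, hω']
  have h2 := lintegral_mul_eq_lintegral_mul_lintegral_of_independent_measurableSpace hF hF' hind
    (hΦ' c) (g := (A c).indicator fun _ => 1)
    (@Measurable.indicator _ _ (_) _ _ _ _ measurable_const (hA' c))
  rw [lintegral_indicator (hA c), setLIntegral_one, mul_comm] at h2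
  rw [h1, ← lintegral_indicator (hA c)]
  refine Eq.trans (lintegral_congr fun ω => ?_) h2
  by_cases hω : ω ∈ A c <;> simp [hω]

end Run

end MirrorSCSG

/-! ### Integration of the epoch bound over the previous iterate. -/

theorem mainTheorem6
    {Ω E : Type*} [MeasurableSpace Ω] (P : Measure Ω) [IsProbabilityMeasure P]
    [NormedAddCommGroup E] [InnerProductSpace ℝ E] [CompleteSpace E]
    [MeasurableSpace E] [BorelSpace E]
    {n : ℕ} (X : Set E) (f : Fin n → E → ℝ) (ψ w : E → ℝ) (xs : E)
    (hX : Convex ℝ X) (hψ : ConvexOn ℝ X ψ)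
    (hf : ∀ i, ∀ x ∈ X, DifferentiableAt ℝ (f i) x)
    (hw : ∀ x ∈ X, DifferentiableAt ℝ w x)
    (hxs : xs ∈ X) (hmin : IsMinOn (objective f ψ) X xs)
    (G : E → ℝ) (g : ℝ → ℝ) (CG L μ : ℝ)
    (hG : IsCHEF G g CG)
    (hB1 : ∀ x ∈ X, ∀ y ∈ X, G (x - y) ≤ bregman w x y)
    (hL : 0 < L)
    (hB2 : ∀ i, ∀ x : E, ∀ y ∈ X,
      0 ≤ bregman (f i) x y ∧ bregman (f i) x y ≤ L * G (x - y))
    (hμ : 0 ≤ μ)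
    (hB3 : ∀ x ∈ X, μ * bregman w xs x ≤ objective f ψ x - objective f ψ xs)
    (T : ℕ) (η m : ℕ → ℝ) (B b : ℕ → ℕ) (prox : ℕ → E → E → E)
    (X₀ : Ω → E) (I : ℕ → Ω → Finset (Fin n)) (N : ℕ → Ω → ℕ)
    (J : ℕ → ℕ → Ω → Finset (Fin n))
    (hrun : IsRun P X f ψ w xs T η m B b prox X₀ I N J)
    (α ξ Γ : ℝ) (hα : 1 < α) (hξ : 0 < ξ) (hΓ : Γ = 1 / (4 * α ^ (1 / ξ)))
    (j : ℕ) (hj : j ∈ Set.Icc 1 T)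
    (hη : 6 * η j * L ≤ min 1 (b j * g (Γ / (3 * CG))))
    (hm : max (b j : ℝ) (4 * CG * α ^ j) / Γ ≤ m j)
    (hB : 5 / (8 * Γ) * g (Γ / (3 * CG)) * (m j / g (1 / m j)) ≤ B j) :
    expGap P f ψ xs (iterate f prox X₀ I N J j)
        + ENNReal.ofReal (4 * b j * (1 - Γ) / (3 * η j) * (1 / m j) + μ / 3)
          * expDiv P w xs (iterate f prox X₀ I N J j)
      ≤ ENNReal.ofReal (4 * Γ) * expGap P f ψ xs (iterate f prox X₀ I N J (j - 1))
        + ENNReal.ofReal (4 * b j * (1 - Γ) / (3 * η j) * (1 / m j))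
          * expDiv P w xs (iterate f prox X₀ I N J (j - 1))
        + (if B j < n then ENNReal.ofReal (1 / (6 * α ^ j)) * dH f G L xs else 0) := by
  obtain ⟨p, rfl⟩ : ∃ p, j = p + 1 := ⟨j - 1, by have := hj.1; omega⟩
  rw [Nat.add_sub_cancel]
  have hp : p + 1 ≤ T := hj.2
  obtain ⟨hB1', hBn⟩ := hrun.batch_size _ hj
  obtain ⟨hb1, hbn⟩ := hrun.mini_size _ hj
  have hη0 := hrun.stepsize_pos _ hj
  have H : IsProblem X f ψ w xs G L :=
    { convexOn := hψ
      diff_loss := hf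
      diff_mirror := hw
      mem := hxs
      isMinOn := hmin
      le_mirror := hB1
      pos := hL
      loss_nonneg := fun i x y hy => (hB2 i x y hy).1
      loss_le := fun i x y hy => (hB2 i x y hy).2
      card_pos := by omega
      env_nonneg := hG.nonneg
      env_symm := hG.symm }
  have hαξ : 1 ≤ α ^ (1 / ξ) := Real.one_le_rpow hα.le (by positivity)
  have hΓ0 : 0 < Γ := by rw [hΓ]; positivity
  have hΓ1 : Γ ≤ 1 / 4 := by
    rw [hΓ, div_le_div_iff₀ (by positivity) (by norm_num)]
    linarith
  let Δ : E → ℝ := fun x => objective f ψ x - objective f ψ xs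
  let D : E → ℝ := bregman w xs
  have hΔm : IsSampleMeasurable f prox T B b X₀ Δ := fun I' N' J' h1 h2 j hj =>
    (hrun.objective_meas I' N' J' h1 h2 j hj).sub_const _
  have hDm : IsSampleMeasurable f prox T B b X₀ D := hrun.divergence_meas
  let Y : ℕ → Ω → E := fun j ω => sampleIter f prox B b (X₀ ω) (epochSample I N J ω) j
  have hmem : ∀ ω, Y p ω ∈ X := fun ω => hrun.sampleIter_mem ω _ (by omega)
  have hle : (⨆ s ∈ {s : Source | s.epoch ≤ p}, sourceSigma X₀ I N J s) ≤ _ :=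
    iSup₂_le fun s _ => hrun.sourceSigma_le s
  have hΔY : Measurable fun ω => Δ (Y p ω) :=
    (hrun.measurable_sampleIter_self hΔm (by omega)).mono hle le_rfl
  have hDY : Measurable fun ω => D (Y p ω) :=
    (hrun.measurable_sampleIter_self hDm (by omega)).mono hle le_rfl
  obtain ⟨hΔs, hΔe⟩ := hrun.lintegral_sampleIter_succ hΔm (fun x hx => H.gap_nonneg hx) hp
  obtain ⟨hDs, hDe⟩ := hrun.lintegral_sampleIter_succ hDm
    (fun x hx => H.mirror_nonneg H.mem hx) hp
  -- Almost surely all batches have the right size, so the corrected iterates agree with the true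
  -- ones.
  have hgap : ∀ j ≤ T, expGap P f ψ xs (iterate f prox X₀ I N J j)
      = ∫⁻ ω, ENNReal.ofReal (Δ (Y j ω)) ∂P := fun j hj => by
    refine lintegral_congr_ae ?_
    filter_upwards [hrun.ae_iterate_eq] with ω hω
    rw [hω j hj]
  have hdiv : ∀ j ≤ T, expDiv P w xs (iterate f prox X₀ I N J j)
      = ∫⁻ ω, ENNReal.ofReal (D (Y j ω)) ∂P := fun j hj => by
    refine lintegral_congr_ae ?_
    filter_upwards [hrun.ae_iterate_eq] with ω hω
    rw [hω j hj]
  rw [hgap _ hp, hdiv _ hp, hgap p (by omega), hdiv p (by omega), hΔe, hDe,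
    ← lintegral_const_mul _ hDs, ← lintegral_add_left hΔs,
    ← lintegral_const_mul _ hΔY.ennreal_ofReal, ← lintegral_const_mul _ hDY.ennreal_ofReal,
    ← lintegral_add_left (hΔY.ennreal_ofReal.const_mul _)]
  refine (lintegral_mono fun ω => H.epoch_tsum_le hG hb1 hbn hB1' hBn hη0 hη hΓ0 hΓ1 hα hm hB hμ hB3
    (hmem ω) (fun S R hS hR x hx => hrun.prox_mem _ hj S R hS hR _ (hmem ω) x hx)).trans ?_
  rw [lintegral_add_right _ measurable_const, lintegral_const, measure_univ, mul_one]
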